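/- \textbf{Theorem 2.} Let $m\ge 1$ be an integer (shadowing parameter), $k>0$ (Rician K-factor) and $\bar\gamma>0$ (average signal-to-noise ratio). The fluctuating double-Rayleigh with line-of-sight (fdRLoS) fading channel has instantaneous signal-to-noise ratio $\gamma$ with density $f_\gamma(\gamma)=\int_0^\infty f_{\gamma_x}(\gamma\mid x)\,e^{-x}\,dx$, where, with $k_x=k/x$ and $\bar\gamma_x=\frac{k+x}{k+1}\bar\gamma$, $$f_{\gamma_x}(\gamma\mid x)=\frac{m^m(1+k_x)}{(m+k_x)^m\,\bar\gamma_x}\,e^{-\frac{1+k_x}{\bar\gamma_x}\gamma}\;{}_1F_1\!\left(m;1;\frac{k_x(1+k_x)}{k_x+m}\frac{\gamma}{\bar\gamma_x}\right).$$ Its ergodic capacity under optimal rate adaptation with constant transmit power (ORA) is $\bar C=\int_0^\infty\log_2(1+\gamma)f_\gamma(\gamma)\,d\gamma$. These integrals converge, and $$\bar C=\left(\frac{\bar\gamma}{k+1}\right)^{m-1}\frac{\Gamma(m)}{\ln 2}\sum_{i=0}^{m-1}\frac{(k/m)^i}{(i!)^2\,\Gamma(m-i)}\;G_i\!\left(\frac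 km,\frac{k+1}{\bar\gamma}\right),$$ where $G_i$ is the extended generalized bivariate Meijer G-function $$G_i(x,y)=G^{1,1:1,0:3,1}_{1,1:0,1:2,4}\left(\begin{matrix}1\\ m-i\end{matrix}\,\middle|\,\begin{matrix}-\\0\end{matrix}\,\middle|\,\begin{matrix}m-1,\;m\\ m-1,\;m-1,\;m+i,\;1\end{matrix}\,\middle|\,x,y\right)=\frac1{(2\pi \mathrm{j})^2}\int\!\!\int\Psi_1(s+t)\Psi_2(s)\Psi_3(t)\,x^{-s}y^{-t}\,ds\,dt,$$ $$\Psi_1(\tau)=\Gamma(m-i+\tau)\Gamma(-\tau),\qquad \Psi_2(\tau)=\Gamma(\tau),\qquad \Psi_3(\tau)=\frac{\Gamma(m-1+\tau)^2\,\Gamma(m+i+\tau)\,\Gamma(2-m-\tau)}{\Gamma(m+\tau)\,\Gamma(-\tau)}.$$ Here $t$ runs upwards along a vertical line that separates the poles of $\Gamma(m-1+t)^2\Gamma(m+i+t)$ (on its left) from those of $\Gamma(2-m-t)$ (on its right), and, for each such $t$, $s$ runs from $-\mathrm{j}\infty$ to $+\mathrm{j}\infty$ along a vertical line, indented if necessary,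 that separates the poles of $\Gamma(m-i+s+t)\Gamma(s)$ (on its left) from those of $\Gamma(-s-t)$ (on its right). Such contours exist, both integrals converge absolutely, and the value does not depend on the choice of the contours. -/

import Mathlib

open MeasureTheory Set

noncomputable section

/-! ### The fluctuating double-Rayleigh with line-of-sight (fdRLoS) channel -/

/-- Kummer's confluent hypergeometric function `₁F₁(a; b; z)` of real arguments. -/
def kummerF (a b z : ℝ) : ℝ :=
  ∑' n : ℕ, (ascPochhammer ℝ n).eval a / ((ascPochhammer ℝ n).eval b * (n.factorial : ℝ)) * z ^ n

namespace FdRLoS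

/-- Conditional K-factor `k_x = k / x`. -/
def condK (k x : ℝ) : ℝ := k / x

/-- Conditional average signal-to-noise ratio `γ̄_x = (k + x) / (k + 1) * γ̄`. -/
def condSNR (k snr x : ℝ) : ℝ := (k + x) / (k + 1) * snr

/-- The density `f_{γ_x}(γ | x)` of the instantaneous signal-to-noise ratio `γ`, conditioned on the
squared amplitude `x` of one of the two complex Gaussian scattering coefficients, with shadowing
parameter `m`, Rician K-factor `k` and average signal-to-noise ratio `snr`. -/
def condPdf (m k snr x γ : ℝ) : ℝ :=
  m ^ m * (1 + condK k x) / ((m + condK k x) ^ m * condSNR k snr x) *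
    Real.exp (-((1 + condK k x) / condSNR k snr x * γ)) *
    kummerF m 1 (condK k x * (1 + condK k x) / (condK k x + m) * (γ / condSNR k snr x))

/-- The density `f_γ(γ) = ∫_0^∞ f_{γ_x}(γ | x) e^{-x} dx` of the instantaneous signal-to-noise
ratio of the fdRLoS channel. -/
def pdf (m k snr γ : ℝ) : ℝ := ∫ x in Ioi (0 : ℝ), condPdf m k snr x γ * Real.exp (-x)

/-- The ergodic capacity (per unit bandwidth) under optimal rate adaptation with constant transmit
power, `∫_0^∞ log₂(1 + γ) f_γ(γ) dγ`. -/
def capacityORA (m k snr : ℝ) : ℝ :=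
  ∫ γ in Ioi (0 : ℝ), Real.logb 2 (1 + γ) * pdf m k snr γ

end FdRLoS

/-! ### The extended generalized bivariate Meijer G-function -/

namespace Meijer

/-- One block of parameters of a Meijer-type kernel: the upper parameters `a₁, …, a_p`, the lower
parameters `b₁, …, b_q`, and the numbers `m ≤ q`, `n ≤ p` of those that enter the numerator. -/
structure Block where
  /-- number of lower parameters in the numerator -/
  m : ℕ
  /-- number of upper parameters in the numerator -/
  n : ℕ
  /-- upper parameters -/
  a : List ℂ
  /-- lower parameters -/
  b : List ℂ

namespace Block

/-- The kernel
`Ψ(τ) = ∏_{j ≤ m} Γ(b_j + τ) ∏_{j ≤ n} Γ(1 - a_j - τ) /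
  (∏_{n < j ≤ p} Γ(a_j + τ) ∏_{m < j ≤ q} Γ(1 - b_j - τ))`.
(With Mathlib's convention `Γ = 0` at the poles of `Γ`, and `x / 0 = 0`, a pole of a Gamma
function in the denominator correctly yields the value `0`.) -/
def kernel (B : Block) (τ : ℂ) : ℂ :=
  (((B.b.take B.m).map fun β => Complex.Gamma (β + τ)).prod *
      ((B.a.take B.n).map fun α => Complex.Gamma (1 - α - τ)).prod) /
    (((B.a.drop B.n).map fun α => Complex.Gamma (α + τ)).prod *
      ((B.b.drop B.m).map fun β => Complex.Gamma (1 - β - τ)).prod)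

/-- The poles of the numerator factors `Γ(b_j + τ)`. -/
def leftPoles (B : Block) : Set ℂ := {τ | ∃ β ∈ B.b.take B.m, ∃ N : ℕ, τ = -β - N}

/-- The poles of the numerator factors `Γ(1 - a_j - τ)`. -/
def rightPoles (B : Block) : Set ℂ := {τ | ∃ α ∈ B.a.take B.n, ∃ N : ℕ, τ = 1 - α + N}

/-- The points at which a denominator factor `Γ(a_j + τ)` or `Γ(1 - b_j - τ)` has a pole, so that
the kernel carries a factor vanishing there. -/
def denomZeros (B : Block) : Set ℂ :=
  {τ | (∃ α ∈ B.a.drop B.n, ∃ N : ℕ, τ = -α - N) ∨ (∃ β ∈ B.b.drop B.m, ∃ N : ℕ, τ = 1 - β + N)}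

end Block

/-- A Mellin–Barnes contour from `-i∞` to `+i∞`, presented (up to homology) as the vertical line
`Re s = abscissa` together with finitely many circles of a common radius, which realize the
indentations of the contour. A circle whose centre is to the right of the line is run through
counterclockwise, one whose centre is to the left of the line clockwise. -/
structure Contour where
  /-- real part of the vertical line -/
  abscissa : ℝ
  /-- centres of the circles -/
  centres : Finset ℂ
  /-- radius of the circles -/
  radius : ℝ

namespace Contour

/-- The contour separates `A` from `B`: all points of `A` are on its left and all points of `B` are
on its right. In detail: no point of `A ∪ B` is on the line; the circles are centred at exactly those
points of `A` that are to the right of the line and those points of `B` that are to the left of it;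
and the circles neither meet the line nor have another point of `A ∪ B` on or inside them. -/
structure Separates (L : Contour) (A B : Set ℂ) : Prop where
  radius_pos : 0 < L.radius
  off_line : ∀ z ∈ A ∪ B, z.re ≠ L.abscissa
  left : ∀ z ∈ A, (z ∈ L.centres ↔ L.abscissa < z.re)
  right : ∀ z ∈ B, (z ∈ L.centres ↔ z.re < L.abscissa)
  centres_subset : ∀ z ∈ L.centres, z ∈ A ∪ B
  circle_off_line : ∀ z ∈ L.centres, L.radius < |z.re - L.abscissa|
  circle_isolates : ∀ z ∈ L.centres, ∀ w ∈ A ∪ B, w ≠ z → L.radius < dist w z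

/-- The line of the contour, `v ↦ abscissa + i v`. -/
def line (L : Contour) (v : ℝ) : ℂ := (L.abscissa : ℂ) + (v : ℂ) * Complex.I

/-- The contour integral `∫_L f(s) ds`. -/
def integral (L : Contour) (f : ℂ → ℂ) : ℂ :=
  (∫ v : ℝ, f (L.line v) * Complex.I) +
    ∑ z ∈ L.centres,
      (if L.abscissa < z.re then (1 : ℂ) else -1) * circleIntegral f z L.radius

end Contour

/-- A vertical line `Re t = c`, as a contour. -/
def lineContour (c : ℝ) : Contour := ⟨c, ∅, 1⟩

/-- Poles in the variable `s`, for given `t`, of the factors `Γ(b + s + t)` of `Ψ₁(s + t)` and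
`Γ(b + s)` of `Ψ₂(s)`. -/
def innerLeft (B₁ B₂ : Block) (t : ℂ) : Set ℂ := {s | s + t ∈ B₁.leftPoles ∨ s ∈ B₂.leftPoles}

/-- Poles in the variable `s`, for given `t`, of the factors `Γ(1 - a - s - t)` of `Ψ₁(s + t)` and
`Γ(1 - a - s)` of `Ψ₂(s)`. -/
def innerRight (B₁ B₂ : Block) (t : ℂ) : Set ℂ := {s | s + t ∈ B₁.rightPoles ∨ s ∈ B₂.rightPoles}

/-- Admissible contours for the double Mellin–Barnes integral: the variable `t` runs over the line
`Re t = c`, and, for each such `t`, the variable `s` runs over the contour `L t`.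
* The `t`-line separates the poles of the numerator of `Ψ₃`.
* For each `t` on this line, `L t` separates the poles in `s` of the numerator of `Ψ₁(s + t) Ψ₂(s)`.
* The points `t` at which a pole in `s` that has to be on the left of `L t` collides with one that
  has to be on its right (the singularities in `t` of the `s`-integral) are on the side of the
  `t`-line that the separation requires, except those that are cancelled by a reciprocal Gamma
  factor of `Ψ₃(t)`. -/
structure Admissible (B₁ B₂ B₃ : Block) (c : ℝ) (L : ℂ → Contour) : Prop where
  outer : (lineContour c).Separates B₃.leftPoles B₃.rightPoles
  inner : ∀ t : ℂ, t.re = c → (L t).Separates (innerLeft B₁ B₂ t) (innerRight B₁ B₂ t)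
  collide_right : ∀ τ ∈ B₁.rightPoles, ∀ s ∈ B₂.leftPoles, c < (τ - s).re ∨ τ - s ∈ B₃.denomZeros
  collide_left : ∀ τ ∈ B₁.leftPoles, ∀ s ∈ B₂.rightPoles, (τ - s).re < c ∨ τ - s ∈ B₃.denomZeros

/-- The integrand of the `s`-integral, `Ψ₁(s + t) Ψ₂(s) x^{-s}`. -/
def innerIntegrand (B₁ B₂ : Block) (x : ℂ) (t s : ℂ) : ℂ :=
  B₁.kernel (s + t) * B₂.kernel s * x ^ (-s)

/-- The integrand of the `t`-integral, `Ψ₃(t) y^{-t} ∫_{L t} Ψ₁(s + t) Ψ₂(s) x^{-s} ds`. -/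
def outerIntegrand (B₁ B₂ B₃ : Block) (x y : ℂ) (L : ℂ → Contour) (t : ℂ) : ℂ :=
  B₃.kernel t * y ^ (-t) * (L t).integral (innerIntegrand B₁ B₂ x t)

/-- `G` is the value at `(x, y)` of the extended generalized bivariate Meijer G-function
`(1 / (2πi)²) ∫∫ Ψ₁(s + t) Ψ₂(s) Ψ₃(t) x^{-s} y^{-t} ds dt`: admissible contours exist, and for all
admissible contours the integrals converge absolutely and the result is `G`. -/
def HasBivariateG (B₁ B₂ B₃ : Block) (x y G : ℂ) : Prop :=
  (∃ (c : ℝ) (L : ℂ → Contour), Admissible B₁ B₂ B₃ c L) ∧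
  ∀ (c : ℝ) (L : ℂ → Contour), Admissible B₁ B₂ B₃ c L →
    (∀ t : ℂ, t.re = c → Integrable fun v : ℝ => innerIntegrand B₁ B₂ x t ((L t).line v)) ∧
    Integrable (fun v : ℝ => outerIntegrand B₁ B₂ B₃ x y L ((lineContour c).line v)) ∧
    1 / (2 * (Real.pi : ℂ) * Complex.I) ^ 2 *
      (lineContour c).integral (outerIntegrand B₁ B₂ B₃ x y L) = G

open Classical in
/-- The extended generalized bivariate Meijer G-function (with the value `0` where the defining
double integral does not make sense). -/
def bivariateG (B₁ B₂ B₃ : Block) (x y : ℂ) : ℂ :=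
  if h : ∃ G : ℂ, HasBivariateG B₁ B₂ B₃ x y G then h.choose else 0

end Meijer

/-! The three blocks of parameters of
`G^{1,1:1,0:3,1}_{1,1:0,1:2,4}(1; m - i | -; 0 | m - 1, m; m - 1, m - 1, m + i, 1 | x, y)`. -/

/-- `Ψ₁(τ) = Γ(m - i + τ) Γ(-τ)`. -/
def capacityBlock₁ (m i : ℕ) : Meijer.Block := ⟨1, 1, [1], [(m : ℂ) - i]⟩

/-- `Ψ₂(τ) = Γ(τ)`. -/
def capacityBlock₂ : Meijer.Block := ⟨1, 0, [], [0]⟩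

/-- `Ψ₃(τ) = Γ(m - 1 + τ)² Γ(m + i + τ) Γ(2 - m - τ) / (Γ(m + τ) Γ(-τ))`. -/
def capacityBlock₃ (m i : ℕ) : Meijer.Block :=
  ⟨3, 1, [(m : ℂ) - 1, (m : ℂ)], [(m : ℂ) - 1, (m : ℂ) - 1, (m : ℂ) + i, 1]⟩

end

noncomputable section

open Filter Topology

/-! ### Shifting Mellin–Barnes contours across simple poles -/

/-! Both sides of the formula reduce to the same real double integrals. Put κ = k/m, y = (k+1)/γ̄
and b = m-1-i.

Capacity side. For integer m, Kummer's transformation turns ₁F₁(m;1;z) into e^z times a polynomial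
(`kummerF_natCast_succ_one`). Since 1/x - κ/(x(x+κ)) = 1/(x+κ), the two exponentials merge, and the
conditional density becomes a finite combination of terms γ^i x^b (x+κ)^{-(b+2i+1)} e^{-yγ/(x+κ)}
(`condPdf_eq_sum`). The substitution γ = g(x+κ)/y then gives ln 2 · C̄ = ∑ C(m-1,i) κ^i/i! · M_i,
where M_i is `logMoment b i κ y`.

Meijer side. The s-integral is a Parseval integral: Γ(b+1+w)Γ(-w) is the Mellin transform of
b!(1+u)^{-(b+1)} at -w, and Γ(s)κ^{-s} is that of e^{-κu}. It equals 2πi Γ(-t) ∫ x^b e^{-x} (x+κ)^t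
dx (`integral_gammaTriple`). The factor Γ(-t) cancels the reciprocal Gamma factor of Ψ₃. With p =
t+m-1, what remains of Ψ₃ is Γ(i+1+p) · Γ(1-p)Γ(p)/p, whose second factor is the Mellin transform of
log(1+u) at -p. Fubini and Mellin inversion produce log(1+g(x+κ)/y) under the integral
(`integral_logMellin_mul_Gamma`), so that G_i = y^{m-1} M_i (`hasBivariateG_capacityBlock`).

Contours. Separation in t means exactly 0 < Re p < 1. Then Re t lies strictly between consecutive
integers, and every pole in s is simple. Subtracting principal parts shows that the s-integral is
the same over all separating contours (`Meijer.Contour.integral_eq_integral`), so one contour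
suffices. A vertical line works for m ≥ 2. For m = 1 the pole -t of Γ(-s-t) lies to the left of the
pole 0 of Γ(s), and one circle is needed; its residue is the boundary term of an integration by
parts (`shiftedGamma_zero_eq`). -/

/-- Near `z`, the function `f` is `ρ / (s - z)` plus a function analytic at `z`. -/
def HasSimplePart (f : ℂ → ℂ) (ρ z : ℂ) : Prop :=
  ∃ h : ℂ → ℂ, AnalyticAt ℂ h z ∧ ∀ᶠ s in 𝓝[≠] z, f s = ρ * (s - z)⁻¹ + h s

theorem AnalyticAt.dslope_self {φ : ℂ → ℂ} {z : ℂ} (h : AnalyticAt ℂ φ z) :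
    AnalyticAt ℂ (dslope φ z) z := by
  obtain ⟨p, hp⟩ := h
  exact ⟨_, hp.has_fpower_series_dslope_fslope⟩

/-- The analytic remainder is the difference quotient (φ s - φ z)/(s - z), that is, `dslope φ z`. -/
theorem HasSimplePart.of_analytic_mul {f φ : ℂ → ℂ} {z : ℂ} (hφ : AnalyticAt ℂ φ z)
    (h : ∀ᶠ s in 𝓝[≠] z, f s = φ s * (s - z)⁻¹) : HasSimplePart f (φ z) z := by
  refine ⟨dslope φ z, hφ.dslope_self, ?_⟩
  filter_upwards [h, self_mem_nhdsWithin] with s hs hne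
  have hne' : s - z ≠ 0 := sub_ne_zero.2 hne
  have := sub_smul_dslope φ z s
  rw [smul_eq_mul] at this
  rw [hs]
  field_simp
  linear_combination -this

/-- The function of the punctured limits of `g`. -/
def puncturedLim (g : ℂ → ℂ) (z : ℂ) : ℂ := limUnder (𝓝[≠] z) g

theorem puncturedLim_eq_of_eventuallyEq {g h : ℂ → ℂ} {z : ℂ} (hh : ContinuousAt h z)
    (hgh : g =ᶠ[𝓝[≠] z] h) : puncturedLim g z = h z :=
  Tendsto.limUnder_eq ((hh.tendsto.mono_left nhdsWithin_le_nhds).congr' hgh.symm)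

/-- Punctured limits fill in removable singularities all at once: at points s ≠ z near z the
agreement with h holds in a full neighbourhood, and at z it is the hypothesis. -/
theorem analyticAt_puncturedLim {g h : ℂ → ℂ} {z : ℂ} (hh : AnalyticAt ℂ h z)
    (hgh : g =ᶠ[𝓝[≠] z] h) : AnalyticAt ℂ (puncturedLim g) z := by
  refine hh.congr ?_
  have h1 := eventually_eventually_nhds.2 (eventually_nhdsWithin_iff.1 hgh)
  filter_upwards [h1, hh.eventually_analyticAt] with s hs hcont
  refine (puncturedLim_eq_of_eventuallyEq hcont.continuousAt ?_).symm
  rcases eq_or_ne s z with rfl | hne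
  · exact hgh
  · refine Filter.Eventually.filter_mono nhdsWithin_le_nhds ?_
    filter_upwards [hs, isOpen_compl_singleton.mem_nhds hne] with w hw hwz using hw hwz

/-- Residue theorem for one simple pole. After subtraction of the principal part the singularity is
removable, and Cauchy's theorem kills the rest. -/
theorem HasSimplePart.circleIntegral_eq {f : ℂ → ℂ} {ρ z : ℂ} {r : ℝ} (hr : 0 < r)
    (hf : HasSimplePart f ρ z) (hfa : ∀ w ∈ Metric.closedBall z r, w ≠ z → AnalyticAt ℂ f w) :
    circleIntegral f z r = 2 * Real.pi * Complex.I * ρ := by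
  set g : ℂ → ℂ := fun s => f s - ρ * (s - z)⁻¹ with hg
  have hinv : ∀ w, w ≠ z → AnalyticAt ℂ (fun s : ℂ => ρ * (s - z)⁻¹) w := fun w hw =>
    analyticAt_const.mul ((analyticAt_id.sub analyticAt_const).inv (sub_ne_zero.2 hw))
  have hga : ∀ w ∈ Metric.closedBall z r, w ≠ z → AnalyticAt ℂ g w := fun w hw hne =>
    (hfa w hw hne).sub (hinv w hne)
  have hG : ∀ w ∈ Metric.closedBall z r, AnalyticAt ℂ (puncturedLim g) w := by
    intro w hw
    rcases eq_or_ne w z with rfl | hne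
    · obtain ⟨h, hh, hfh⟩ := hf
      refine analyticAt_puncturedLim hh ?_
      filter_upwards [hfh] with s hs
      simp [hg, hs]
    · exact analyticAt_puncturedLim (hga w hw hne) EventuallyEq.rfl
  have hGc : ContinuousOn (puncturedLim g) (Metric.closedBall z r) := fun w hw =>
    (hG w hw).continuousAt.continuousWithinAt
  have h0 : circleIntegral (puncturedLim g) z r = 0 :=
    Complex.circleIntegral_eq_zero_of_differentiable_on_off_countable hr.le countable_empty hGc
      fun w hw => (hG w (Metric.ball_subset_closedBall hw.1)).differentiableAt
  have hcongr : EqOn f (fun s => puncturedLim g s + ρ * (s - z)⁻¹) (Metric.sphere z r) := by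
    intro w hw
    have hne : w ≠ z := by
      rintro rfl
      simp at hw
      exact hr.ne hw
    have := puncturedLim_eq_of_eventuallyEq
      (hga w (Metric.sphere_subset_closedBall hw) hne).continuousAt EventuallyEq.rfl
    change f w = puncturedLim g w + ρ * (w - z)⁻¹
    rw [this]
    simp only [hg]
    ring
  rw [circleIntegral.integral_congr hr.le hcongr, circleIntegral.integral_add, h0,
    circleIntegral.integral_const_mul, circleIntegral.integral_sub_center_inv _ hr.ne']
  · ring
  · exact (hGc.mono Metric.sphere_subset_closedBall).circleIntegrable hr.le
  · refine ContinuousOn.circleIntegrable hr.le fun w hw => ?_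
    have hne : w ≠ z := by
      rintro rfl
      simp at hw
      exact hr.ne hw
    exact (hinv w hne).continuousAt.continuousWithinAt

/-- The filter of points of the strip `σ₁ ≤ Re s ≤ σ₂` whose imaginary part tends to infinity. -/
def stripInfty (σ₁ σ₂ : ℝ) : Filter ℂ :=
  comap (fun s : ℂ => |s.im|) atTop ⊓ 𝓟 {s | σ₁ ≤ s.re ∧ s.re ≤ σ₂}

theorem tendsto_inv_sub_stripInfty (σ₁ σ₂ : ℝ) (z : ℂ) :
    Tendsto (fun s : ℂ => (s - z)⁻¹) (stripInfty σ₁ σ₂) (𝓝 0) := by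
  refine tendsto_inv₀_cobounded.comp ?_
  rw [← tendsto_norm_atTop_iff_cobounded]
  have h : Tendsto (fun s : ℂ => |s.im| - |z.im|) (stripInfty σ₁ σ₂) atTop :=
    tendsto_atTop_add_const_right _ _ (tendsto_comap.mono_left inf_le_left)
  refine tendsto_atTop_mono (fun s => ?_) h
  calc |s.im| - |z.im| ≤ |s.im - z.im| := abs_sub_abs_le_abs_sub _ _
    _ = |(s - z).im| := by simp
    _ ≤ ‖s - z‖ := Complex.abs_im_le_norm _

theorem exists_bound_of_tendsto_stripInfty {g : ℂ → ℂ} {σ₁ σ₂ : ℝ}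
    (h : Tendsto g (stripInfty σ₁ σ₂) (𝓝 0)) {ε : ℝ} (hε : 0 < ε) :
    ∃ T : ℝ, ∀ s : ℂ, σ₁ ≤ s.re → s.re ≤ σ₂ → T ≤ |s.im| → ‖g s‖ ≤ ε := by
  have h1 : ∀ᶠ s in stripInfty σ₁ σ₂, ‖g s‖ < ε := by
    have := h.norm
    rw [norm_zero] at this
    exact this.eventually (gt_mem_nhds hε)
  rw [stripInfty, eventually_inf_principal, eventually_comap] at h1
  obtain ⟨T, hT⟩ := eventually_atTop.1 h1
  exact ⟨T, fun s hs1 hs2 hs => (hT _ hs s rfl ⟨hs1, hs2⟩).le⟩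

/-- Cauchy's theorem on rectangles of height 2T. The horizontal sides vanish as T → ∞ because G
tends to 0 uniformly across the strip. -/
theorem integral_vertical_eq {G : ℂ → ℂ} {σ₁ σ₂ : ℝ} (h12 : σ₁ ≤ σ₂)
    (hG : DifferentiableOn ℂ G {s | σ₁ ≤ s.re ∧ s.re ≤ σ₂})
    (hlim : Tendsto G (stripInfty σ₁ σ₂) (𝓝 0))
    (h1 : Integrable fun v : ℝ => G (σ₁ + v * Complex.I))
    (h2 : Integrable fun v : ℝ => G (σ₂ + v * Complex.I)) :
    ∫ v : ℝ, G (σ₁ + v * Complex.I) = ∫ v : ℝ, G (σ₂ + v * Complex.I) := by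
  have hrect : ∀ T : ℝ, 0 ≤ T →
      ‖(∫ v in (-T)..T, G (σ₂ + v * Complex.I)) - ∫ v in (-T)..T, G (σ₁ + v * Complex.I)‖ =
      ‖(∫ x in σ₁..σ₂, G (x + (T : ℝ) * Complex.I)) -
        ∫ x in σ₁..σ₂, G (x + (-T : ℝ) * Complex.I)‖ := by
    intro T hT
    have := Complex.integral_boundary_rect_eq_zero_of_differentiableOn G
      ⟨σ₁, -T⟩ ⟨σ₂, T⟩ (hG.mono ?_)
    · simp only [smul_eq_mul] at this
      have h3 : Complex.I * ((∫ v in (-T)..T, G (σ₂ + v * Complex.I)) -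
          ∫ v in (-T)..T, G (σ₁ + v * Complex.I)) =
          (∫ x in σ₁..σ₂, G (x + (T : ℝ) * Complex.I)) -
            ∫ x in σ₁..σ₂, G (x + (-T : ℝ) * Complex.I) := by
        linear_combination this
      rw [← h3, norm_mul, Complex.norm_I, one_mul]
    · intro s hs
      rw [Complex.mem_reProdIm, uIcc_of_le h12] at hs
      exact hs.1
  have hlim1 := (intervalIntegral_tendsto_integral h2 tendsto_neg_atTop_atBot tendsto_id).sub
    (intervalIntegral_tendsto_integral h1 tendsto_neg_atTop_atBot tendsto_id)
  have hlim2 : Tendsto (fun T : ℝ => (∫ v in (-T)..T, G (σ₂ + v * Complex.I)) -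
      ∫ v in (-T)..T, G (σ₁ + v * Complex.I)) atTop (𝓝 0) := by
    rw [Metric.tendsto_atTop]
    intro ε hε
    -- With this bound each horizontal side contributes less than ε/2; the `+ 1` covers σ₁ = σ₂.
    have hδ : 0 < ε / (2 * (σ₂ - σ₁ + 1)) := by
      have : 0 < σ₂ - σ₁ + 1 := by linarith
      positivity
    obtain ⟨T₀, hT₀⟩ := exists_bound_of_tendsto_stripInfty hlim hδ
    refine ⟨max T₀ 0, fun T hT => ?_⟩
    have hT0 : 0 ≤ T := (le_max_right _ _).trans hT
    have hTT : T₀ ≤ T := (le_max_left _ _).trans hT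
    rw [dist_zero_right, hrect T hT0]
    have hb : ∀ u : ℝ, |u| = T → ‖∫ x in σ₁..σ₂, G (x + (u : ℝ) * Complex.I)‖ ≤
        ε / (2 * (σ₂ - σ₁ + 1)) * |σ₂ - σ₁| := by
      intro u hu
      refine intervalIntegral.norm_integral_le_of_norm_le_const fun x hx => ?_
      rw [uIoc_of_le h12] at hx
      refine hT₀ _ ?_ ?_ ?_
      · simpa using hx.1.le
      · simpa using hx.2
      · simpa [hu] using hTT
    have h4 : ε / (2 * (σ₂ - σ₁ + 1)) * |σ₂ - σ₁| < ε / 2 := by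
      rw [abs_of_nonneg (by linarith), div_mul_eq_mul_div, div_lt_div_iff₀ (by linarith) (by norm_num)]
      nlinarith
    calc _ ≤ _ + _ := norm_sub_le _ _
      _ ≤ _ := add_le_add (hb T (abs_of_nonneg hT0)) (hb (-T) (by rw [abs_neg, abs_of_nonneg hT0]))
      _ < ε := by linarith
  have := tendsto_nhds_unique hlim1 hlim2
  exact (sub_eq_zero.1 this).symm

/-! ### The vertical integral of `1 / s - 1 / (s + R)` -/

theorem integral_cauchy_density (p : ℝ) (hp : p ≠ 0) :
    Integrable (fun v : ℝ => p / (p ^ 2 + v ^ 2)) ∧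
      ∫ v : ℝ, p / (p ^ 2 + v ^ 2) = Real.pi * SignType.sign p := by
  have h : (fun v : ℝ => p / (p ^ 2 + v ^ 2)) = fun v : ℝ => p⁻¹ * (1 + (v / p) ^ 2)⁻¹ := by
    ext v
    have : p ^ 2 + v ^ 2 ≠ 0 := by positivity
    field_simp
  rw [h]
  refine ⟨(integrable_inv_one_add_sq.comp_div hp).const_mul _, ?_⟩
  rw [integral_const_mul, Measure.integral_comp_div (fun v : ℝ => (1 + v ^ 2)⁻¹) p,
    integral_univ_inv_one_add_sq, smul_eq_mul]
  rcases hp.lt_or_gt with h | h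
  · rw [abs_of_neg h, sign_neg h]
    field_simp
    simp
  · rw [abs_of_pos h, sign_pos h]
    field_simp
    simp

/-- Neither reciprocal is integrable alone. The real parts are Cauchy densities, each of integral
±π; the imaginary part is odd, and the difference makes it integrable. -/
theorem integral_inv_sub_inv_vertical (p q : ℝ) (hp : p ≠ 0) (hq : q ≠ 0) :
    Integrable (fun v : ℝ => ((p : ℂ) + v * Complex.I)⁻¹ - ((q : ℂ) + v * Complex.I)⁻¹) ∧
      ∫ v : ℝ, (((p : ℂ) + v * Complex.I)⁻¹ - ((q : ℂ) + v * Complex.I)⁻¹) =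
        Real.pi * ((SignType.sign p : ℝ) - (SignType.sign q : ℝ) : ℝ) := by
  have hinv : ∀ p : ℝ, p ≠ 0 → ∀ v : ℝ, ((p : ℂ) + v * Complex.I)⁻¹ =
      ((p / (p ^ 2 + v ^ 2) : ℝ) : ℂ) - ((v / (p ^ 2 + v ^ 2) : ℝ) : ℂ) * Complex.I := by
    intro p hp v
    have h1 : (p : ℂ) ^ 2 + (v : ℂ) ^ 2 ≠ 0 := by
      have : p ^ 2 + v ^ 2 ≠ 0 := by positivity
      exact_mod_cast this
    refine inv_eq_of_mul_eq_one_left ?_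
    push_cast
    field_simp
    linear_combination (-(v : ℂ) ^ 2) * Complex.I_sq
  set O : ℝ → ℝ := fun v => v / (p ^ 2 + v ^ 2) - v / (q ^ 2 + v ^ 2) with hO
  have hOi : Integrable O := by
    refine Integrable.mono' (((integral_cauchy_density p hp).1.norm.const_mul
      (|q ^ 2 - p ^ 2| / (2 * |q| * |p|)))) ?_ ?_
    · refine (Measurable.aestronglyMeasurable ?_)
      fun_prop
    · refine Eventually.of_forall fun v => ?_
      have h1 : 0 < p ^ 2 + v ^ 2 := by positivity
      have h2 : 0 < q ^ 2 + v ^ 2 := by positivity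
      have hqp : 0 < |q| := abs_pos.2 hq
      have hpp : 0 < |p| := abs_pos.2 hp
      have h3 : O v = v * (q ^ 2 - p ^ 2) / ((p ^ 2 + v ^ 2) * (q ^ 2 + v ^ 2)) := by
        simp only [hO]
        field_simp
        ring
      -- This leaves a multiple of 1/(p² + v²) as a dominating function.
      have h4 : 2 * |q| * |v| ≤ q ^ 2 + v ^ 2 := by
        rw [← sq_abs q, ← sq_abs v]
        nlinarith [sq_nonneg (|q| - |v|)]
      rw [h3, Real.norm_eq_abs, Real.norm_eq_abs, abs_div, abs_mul, abs_mul, abs_div, abs_of_pos h1,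
        abs_of_pos h2, div_mul_div_comm, div_le_div_iff₀ (by positivity) (by positivity)]
      have h5 : 0 ≤ |q ^ 2 - p ^ 2| * |p| * (p ^ 2 + v ^ 2) := by positivity
      nlinarith [mul_le_mul_of_nonneg_left h4 h5]
  have hO0 : ∫ v, O v = 0 := by
    have h1 := integral_neg_eq_self O volume
    have h2 : (fun v => O (-v)) = fun v => -O v := by
      ext v
      simp only [hO, neg_sq]
      ring
    rw [h2, integral_neg] at h1
    linarith
  have hF : (fun v : ℝ => ((p : ℂ) + v * Complex.I)⁻¹ - ((q : ℂ) + v * Complex.I)⁻¹) =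
      fun v : ℝ => ((p / (p ^ 2 + v ^ 2) - q / (q ^ 2 + v ^ 2) : ℝ) : ℂ) -
        (O v : ℂ) * Complex.I := by
    ext v
    rw [hinv p hp, hinv q hq]
    simp only [hO]
    push_cast
    ring
  have hE := (integral_cauchy_density p hp).1.sub (integral_cauchy_density q hq).1
  rw [hF]
  refine ⟨hE.ofReal.sub (hOi.ofReal.mul_const _), ?_⟩
  rw [integral_sub hE.ofReal (hOi.ofReal.mul_const _), integral_mul_const, integral_complex_ofReal,
    integral_complex_ofReal, hO0, integral_sub (integral_cauchy_density p hp).1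
    (integral_cauchy_density q hq).1, (integral_cauchy_density p hp).2,
    (integral_cauchy_density q hq).2]
  push_cast
  ring

/-- The function `s ↦ 1 / (s - z) - 1 / (s - z + R)`. -/
def polePart (R : ℝ) (z s : ℂ) : ℂ := (s - z)⁻¹ - (s - z + R)⁻¹

/-- The auxiliary pole z - R lies to the left of the line and only provides decay, so the integral
records on which side of the line z lies. -/
theorem integral_polePart {R σ : ℝ} {z : ℂ} (h0 : z.re ≠ σ) (hR : z.re - R < σ) :
    Integrable (fun v : ℝ => polePart R z (σ + v * Complex.I)) ∧
      ∫ v : ℝ, polePart R z (σ + v * Complex.I) = if σ < z.re then -2 * (Real.pi : ℂ) else 0 := by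
  have hp : σ - z.re ≠ 0 := sub_ne_zero.2 h0.symm
  have hq : σ - z.re + R ≠ 0 := by linarith [hR] |> fun h : 0 < σ - z.re + R => h.ne'
  obtain ⟨h1, h2⟩ := integral_inv_sub_inv_vertical _ _ hp hq
  have hF : (fun v : ℝ => polePart R z (σ + v * Complex.I)) = fun v : ℝ =>
      (((σ - z.re : ℝ) : ℂ) + ((v - z.im : ℝ) : ℂ) * Complex.I)⁻¹ -
        (((σ - z.re + R : ℝ) : ℂ) + ((v - z.im : ℝ) : ℂ) * Complex.I)⁻¹ := by
    ext v
    have hz := Complex.re_add_im z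
    simp only [polePart]
    congr 2
    · push_cast
      linear_combination hz
    · push_cast
      linear_combination hz
  rw [hF]
  refine ⟨h1.comp_sub_right z.im, ?_⟩
  rw [integral_sub_right_eq_self (fun v : ℝ => (((σ - z.re : ℝ) : ℂ) + (v : ℂ) * Complex.I)⁻¹ -
        (((σ - z.re + R : ℝ) : ℂ) + (v : ℂ) * Complex.I)⁻¹) z.im, h2,
    sign_pos (show 0 < σ - z.re + R by linarith)]
  split_ifs with h
  · rw [sign_neg (by linarith)]
    simp
    ring
  · rw [sign_pos (lt_of_le_of_ne (by linarith) hp.symm)]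
    simp

/-! ### Independence of the separating contour -/

namespace Meijer.Contour

open Classical in
/-- The value of a contour integral in terms of an integral over the line without singularities. -/
theorem integral_eq_of_separates {A B : Set ℂ} {f ρ : ℂ → ℂ}
    (hρ : ∀ z ∈ A ∪ B, HasSimplePart f (ρ z) z) (hf : ∀ z ∉ A ∪ B, AnalyticAt ℂ f z)
    {L : Contour} (hL : L.Separates A B)
    (hint : Integrable fun v : ℝ => f (L.line v)) {S : Finset ℂ} (hS : ∀ z ∈ S, z ∈ A ∪ B)
    (hLS : L.centres ⊆ S) {R : ℝ} (hR : ∀ z ∈ S, z.re - R < L.abscissa) :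
    (Integrable fun v : ℝ => f (L.line v) - ∑ z ∈ S, ρ z * polePart R z (L.line v)) ∧
    L.integral f = (∫ v : ℝ, (f (L.line v) - ∑ z ∈ S, ρ z * polePart R z (L.line v))) * Complex.I -
      2 * Real.pi * Complex.I * ∑ z ∈ S, if z ∈ B then ρ z else 0 := by
  have hK : ∀ z ∈ S, Integrable (fun v : ℝ => ρ z * polePart R z (L.line v)) ∧
      ∫ v : ℝ, ρ z * polePart R z (L.line v) =
        ρ z * if L.abscissa < z.re then -2 * (Real.pi : ℂ) else 0 := by
    intro z hz
    have := integral_polePart (hL.off_line z (hS z hz)) (hR z hz)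
    exact ⟨this.1.const_mul _, by rw [integral_const_mul]; congr 1; exact this.2⟩
  have hKi := integrable_finsetSum S fun z hz => (hK z hz).1
  refine ⟨hint.sub hKi, ?_⟩
  rw [integral_sub hint hKi, integral_finsetSum S fun z hz => (hK z hz).1,
    Finset.sum_congr rfl fun z hz => (hK z hz).2, Contour.integral, integral_mul_const]
  have hcirc : ∀ z ∈ L.centres, circleIntegral f z L.radius = 2 * Real.pi * Complex.I * ρ z := by
    intro z hz
    refine (hρ z (hL.centres_subset z hz)).circleIntegral_eq hL.radius_pos fun w hw hne => ?_
    refine hf w fun hwP => ?_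
    exact absurd (hL.circle_isolates z hz w hwP hne) (not_lt.2 hw)
  have hsum : ∑ z ∈ L.centres, (if L.abscissa < z.re then (1 : ℂ) else -1) *
      circleIntegral f z L.radius = ∑ z ∈ S, if z ∈ L.centres then
        (if L.abscissa < z.re then (1 : ℂ) else -1) * (2 * Real.pi * Complex.I * ρ z) else 0 := by
    rw [Finset.sum_ite_mem, Finset.inter_eq_right.2 hLS]
    exact Finset.sum_congr rfl fun z hz => by rw [hcirc z hz]
  rw [hsum, sub_mul, Finset.sum_mul, Finset.mul_sum, sub_sub, sub_eq_add_neg, add_right_inj,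
    ← Finset.sum_add_distrib, ← Finset.sum_neg_distrib]
  -- Line and circle are balanced pole by pole. A point of B contributes -2πiρ, from the line if it
  -- is on the right and from a clockwise circle otherwise. A point of A contributes 0: on the right
  -- of the line its counterclockwise circle cancels the line term.
  refine Finset.sum_congr rfl fun z hz => ?_
  have hne := hL.off_line z (hS z hz)
  by_cases hzB : z ∈ B
  · have h1 := hL.right z hzB
    by_cases h2 : z.re < L.abscissa
    · simp [h1, h2, h2.not_gt, hzB]
    · have h3 : L.abscissa < z.re := lt_of_le_of_ne (not_lt.1 h2) hne.symm
      simp only [h1, h2, h3, hzB, if_true, if_false]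
      ring
  · have hzA : z ∈ A := (hS z hz).resolve_right hzB
    have h1 := hL.left z hzA
    by_cases h2 : L.abscissa < z.re
    · simp only [h1, h2, hzB, if_true, if_false]
      ring
    · simp [h1, h2, hzB]

/-- The integral of a function with at most simple poles over a contour that separates its poles
does not depend on the contour. -/
theorem integral_eq_integral {A B : Set ℂ} {f ρ : ℂ → ℂ}
    (hρ : ∀ z ∈ A ∪ B, HasSimplePart f (ρ z) z) (hf : ∀ z ∉ A ∪ B, AnalyticAt ℂ f z)
    (hlim : ∀ σ₁ σ₂, Tendsto f (stripInfty σ₁ σ₂) (𝓝 0)) {L₁ L₂ : Contour}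
    (h₁ : L₁.Separates A B) (h₂ : L₂.Separates A B)
    (hi₁ : Integrable fun v : ℝ => f (L₁.line v)) (hi₂ : Integrable fun v : ℝ => f (L₂.line v)) :
    L₁.integral f = L₂.integral f := by
  classical
  wlog h12 : L₁.abscissa ≤ L₂.abscissa generalizing L₁ L₂
  · exact (this h₂ h₁ hi₂ hi₁ (le_of_not_ge h12)).symm
  set S : Finset ℂ := L₁.centres ∪ L₂.centres with hSdef
  have hS : ∀ z ∈ S, z ∈ A ∪ B := by
    intro z hz
    rcases Finset.mem_union.1 hz with hz | hz
    · exact h₁.centres_subset z hz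
    · exact h₂.centres_subset z hz
  -- So large that all auxiliary poles z - R lie to the left of both lines.
  set R : ℝ := (∑ z ∈ S, |z.re|) + |L₁.abscissa| + 1 with hRdef
  have hsum : 0 ≤ ∑ z ∈ S, |z.re| := Finset.sum_nonneg fun _ _ => abs_nonneg _
  have hR0 : 0 < R := by positivity
  have hR1 : ∀ z ∈ S, z.re - R < L₁.abscissa := by
    intro z hz
    have h3 := Finset.single_le_sum (f := fun z : ℂ => |z.re|) (fun _ _ => abs_nonneg _) hz
    have h4 := le_abs_self z.re
    have h5 := neg_abs_le L₁.abscissa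
    linarith
  have hR2 : ∀ z ∈ S, z.re - R < L₂.abscissa := fun z hz => (hR1 z hz).trans_le h12
  obtain ⟨gi₁, e₁⟩ := integral_eq_of_separates hρ hf h₁ hi₁ hS Finset.subset_union_left hR1
  obtain ⟨gi₂, e₂⟩ := integral_eq_of_separates hρ hf h₂ hi₂ hS Finset.subset_union_right hR2
  rw [e₁, e₂]
  -- The residue sums agree because both refer to the same S and B. It remains to compare the
  -- integrals of one function g over two lines.
  congr 2
  set g : ℂ → ℂ := fun s => f s - ∑ z ∈ S, ρ z * polePart R z s with hg
  have hpole : ∀ z ∈ S, ∀ w : ℂ, L₁.abscissa ≤ w.re → w ≠ z → AnalyticAt ℂ (polePart R z) w := by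
    intro z hz w hw hne
    refine ((analyticAt_id.sub analyticAt_const).inv (sub_ne_zero.2 hne)).sub
      (((analyticAt_id.sub analyticAt_const).add analyticAt_const).inv ?_)
    intro h0
    have := congrArg Complex.re h0
    simp at this
    linarith [hR1 z hz]
  -- A pole between the lines is on the wrong side of one of them: a left pole is encircled by `L₁`,
  -- a right pole by `L₂`. Hence S contains all poles of the strip, and g has only removable
  -- singularities there.
  have hmem : ∀ w : ℂ, L₁.abscissa ≤ w.re → w.re ≤ L₂.abscissa → w ∈ A ∪ B → w ∈ S := by
    intro w hw1 hw2 hw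
    have n1 := h₁.off_line w hw
    have n2 := h₂.off_line w hw
    rcases hw with hw | hw
    · exact Finset.mem_union_left _ ((h₁.left w hw).2 (lt_of_le_of_ne hw1 n1.symm))
    · exact Finset.mem_union_right _ ((h₂.right w hw).2 (lt_of_le_of_ne hw2 n2))
  have hga : ∀ w : ℂ, L₁.abscissa ≤ w.re → w.re ≤ L₂.abscissa → w ∉ A ∪ B → AnalyticAt ℂ g w := by
    intro w hw1 hw2 hw
    refine (hf w hw).sub (Finset.analyticAt_fun_sum S fun z hz => analyticAt_const.mul
      (hpole z hz w hw1 ?_))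
    rintro rfl
    exact hw (hS _ hz)
  have hG : ∀ w : ℂ, L₁.abscissa ≤ w.re → w.re ≤ L₂.abscissa →
      AnalyticAt ℂ (puncturedLim g) w := by
    intro w hw1 hw2
    by_cases hw : w ∈ A ∪ B
    · have hwS := hmem w hw1 hw2 hw
      obtain ⟨h, hh, hfh⟩ := hρ w hw
      have han : AnalyticAt ℂ (fun s => h s + ρ w * (s - w + R)⁻¹ -
          ∑ z ∈ S.erase w, ρ z * polePart R z s) w := by
        refine (hh.add (analyticAt_const.mul
          (((analyticAt_id.sub analyticAt_const).add analyticAt_const).inv ?_))).sub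
          (Finset.analyticAt_fun_sum _ fun z hz => analyticAt_const.mul
            (hpole z (Finset.mem_of_mem_erase hz) w hw1 (Finset.ne_of_mem_erase hz).symm))
        simpa using hR0.ne'
      refine analyticAt_puncturedLim han ?_
      filter_upwards [hfh] with s hs
      simp only [hg]
      rw [← Finset.add_sum_erase S _ hwS, hs, polePart]
      ring
    · exact analyticAt_puncturedLim (hga w hw1 hw2 hw) EventuallyEq.rfl
  have hgG : ∀ w : ℂ, L₁.abscissa ≤ w.re → w.re ≤ L₂.abscissa → w ∉ A ∪ B →
      puncturedLim g w = g w := fun w hw1 hw2 hw =>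
    puncturedLim_eq_of_eventuallyEq (hga w hw1 hw2 hw).continuousAt EventuallyEq.rfl
  have hline : ∀ (L : Contour) (v : ℝ), (L.line v).re = L.abscissa := by
    intro L v
    simp [Contour.line]
  have hl₁ : ∀ v : ℝ, puncturedLim g (L₁.line v) = g (L₁.line v) := fun v =>
    hgG _ (hline L₁ v).ge ((hline L₁ v).trans_le h12) fun hP => h₁.off_line _ hP (hline L₁ v)
  have hl₂ : ∀ v : ℝ, puncturedLim g (L₂.line v) = g (L₂.line v) := fun v =>
    hgG _ (h12.trans (hline L₂ v).ge) (hline L₂ v).le fun hP => h₂.off_line _ hP (hline L₂ v)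
  have hglim : Tendsto g (stripInfty L₁.abscissa L₂.abscissa) (𝓝 0) := by
    have h3 : ∀ z ∈ S, Tendsto (fun s => ρ z * polePart R z s)
        (stripInfty L₁.abscissa L₂.abscissa) (𝓝 0) := by
      intro z _
      have h4 := (tendsto_inv_sub_stripInfty L₁.abscissa L₂.abscissa z).sub
        (tendsto_inv_sub_stripInfty L₁.abscissa L₂.abscissa (z - R))
      have h5 := h4.const_mul (ρ z)
      simp only [sub_zero, mul_zero] at h5
      refine h5.congr fun s => ?_
      rw [polePart]
      congr 3
      ring
    have h6 := (hlim L₁.abscissa L₂.abscissa).sub (tendsto_finsetSum S h3)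
    simpa using h6
  have hGlim : Tendsto (puncturedLim g) (stripInfty L₁.abscissa L₂.abscissa) (𝓝 0) := by
    refine hglim.congr' ?_
    -- Above the imaginary parts of all points of S there are no poles left in the strip.
    have h3 : ∀ᶠ s : ℂ in stripInfty L₁.abscissa L₂.abscissa, ∑ z ∈ S, |z.im| < |s.im| :=
      (tendsto_comap.mono_left inf_le_left).eventually (eventually_gt_atTop _)
    have h4 : ∀ᶠ s : ℂ in stripInfty L₁.abscissa L₂.abscissa,
        L₁.abscissa ≤ s.re ∧ s.re ≤ L₂.abscissa := Eventually.filter_mono inf_le_right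
      (mem_principal_self _)
    filter_upwards [h3, h4] with s hs hs'
    refine (hgG s hs'.1 hs'.2 fun hP => ?_).symm
    exact hs.not_ge (Finset.single_le_sum (f := fun z : ℂ => |z.im|) (fun _ _ => abs_nonneg _)
      (hmem s hs'.1 hs'.2 hP))
  have := integral_vertical_eq h12
    (fun w hw => (hG w hw.1 hw.2).differentiableAt.differentiableWithinAt) hGlim
    (gi₁.congr (Eventually.of_forall fun v => (hl₁ v).symm))
    (gi₂.congr (Eventually.of_forall fun v => (hl₂ v).symm))
  calc _ = ∫ v : ℝ, puncturedLim g (L₁.line v) := integral_congr_ae (Eventually.of_forall fun v => (hl₁ v).symm)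
    _ = _ := this
    _ = _ := integral_congr_ae (Eventually.of_forall hl₂)

end Meijer.Contour

/-! ### Singularities and decay of the Gamma function -/

/-- `f` is analytic at `z` up to a simple pole. -/
def AtMostSimplePole (f : ℂ → ℂ) (z : ℂ) : Prop :=
  ∃ φ : ℂ → ℂ, AnalyticAt ℂ φ z ∧ ∀ᶠ s in 𝓝[≠] z, f s = φ s * (s - z)⁻¹

theorem AtMostSimplePole.exists_hasSimplePart {f : ℂ → ℂ} {z : ℂ} (h : AtMostSimplePole f z) :
    ∃ ρ, HasSimplePart f ρ z := by
  obtain ⟨φ, hφ, hf⟩ := h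
  exact ⟨_, HasSimplePart.of_analytic_mul hφ hf⟩

theorem AtMostSimplePole.mul_analyticAt {f g : ℂ → ℂ} {z : ℂ} (hf : AtMostSimplePole f z)
    (hg : AnalyticAt ℂ g z) : AtMostSimplePole (fun s => f s * g s) z := by
  obtain ⟨φ, hφ, hf⟩ := hf
  refine ⟨fun s => φ s * g s, hφ.mul hg, ?_⟩
  filter_upwards [hf] with s hs
  rw [hs]
  ring

theorem AtMostSimplePole.comp_add {f : ℂ → ℂ} {z b : ℂ} (hf : AtMostSimplePole f (z + b)) :
    AtMostSimplePole (fun s => f (s + b)) z := by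
  obtain ⟨φ, hφ, hf⟩ := hf
  refine ⟨fun s => φ (s + b), hφ.comp_of_eq (analyticAt_id.add analyticAt_const) rfl, ?_⟩
  have ht : Tendsto (fun s : ℂ => s + b) (𝓝[≠] z) (𝓝[≠] (z + b)) := by
    refine tendsto_nhdsWithin_iff.2 ⟨?_, ?_⟩
    · exact (Continuous.tendsto (by fun_prop) z).mono_left nhdsWithin_le_nhds
    · filter_upwards [self_mem_nhdsWithin] with s hs
      simpa using hs
  filter_upwards [ht.eventually hf] with s hs
  rw [hs]
  ring

theorem AtMostSimplePole.comp_neg {f : ℂ → ℂ} {z : ℂ} (hf : AtMostSimplePole f (-z)) :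
    AtMostSimplePole (fun s => f (-s)) z := by
  obtain ⟨φ, hφ, hf⟩ := hf
  refine ⟨fun s => -φ (-s), (hφ.comp_of_eq analyticAt_id.neg rfl).neg, ?_⟩
  have ht : Tendsto (fun s : ℂ => -s) (𝓝[≠] z) (𝓝[≠] (-z)) := by
    refine tendsto_nhdsWithin_iff.2 ⟨?_, ?_⟩
    · exact (Continuous.tendsto (by fun_prop) z).mono_left nhdsWithin_le_nhds
    · filter_upwards [self_mem_nhdsWithin] with s hs
      simpa using hs
  filter_upwards [ht.eventually hf] with s hs
  rw [hs, show -s - -z = -(s - z) by ring, inv_neg]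
  ring

theorem Complex.analyticAt_Gamma {s : ℂ} (hs : ∀ n : ℕ, s ≠ -n) : AnalyticAt ℂ Complex.Gamma s := by
  rw [Complex.analyticAt_iff_eventually_differentiableAt]
  have h1 : AnalyticAt ℂ (fun z => (Complex.Gamma z)⁻¹) s :=
    Complex.differentiable_one_div_Gamma.analyticAt s
  have h2 : (Complex.Gamma s)⁻¹ ≠ 0 := inv_ne_zero (Complex.Gamma_ne_zero hs)
  have h3 := (h1.inv h2)
  simp only [Pi.inv_def, inv_inv] at h3
  exact Complex.analyticAt_iff_eventually_differentiableAt.1 h3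

/-- Induction through Γ(s) = Γ(s+1)/s: the division creates the pole at 0 and is harmless at -n-1.
-/
theorem atMostSimplePole_Gamma (n : ℕ) : AtMostSimplePole Complex.Gamma (-n) := by
  induction n with
  | zero =>
    refine ⟨fun s => Complex.Gamma (s + 1), (Complex.analyticAt_Gamma (s := 1) ?_).comp_of_eq
      (analyticAt_id.add analyticAt_const) (by simp), ?_⟩
    · intro n hn
      have := congrArg Complex.re hn
      simp at this
      linarith [(Nat.cast_nonneg n : (0:ℝ) ≤ n)]
    · filter_upwards [self_mem_nhdsWithin] with s hs
      have hs' : s ≠ 0 := by simpa using hs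
      rw [Complex.Gamma_add_one s hs']
      simp
      field_simp
  | succ n ih =>
    have h1 : AtMostSimplePole (fun s => Complex.Gamma (s + 1)) (-((n + 1 : ℕ) : ℂ)) := by
      refine AtMostSimplePole.comp_add (f := Complex.Gamma) ?_
      convert ih using 1
      push_cast
      ring
    have hne : (-((n + 1 : ℕ) : ℂ)) ≠ 0 := neg_ne_zero.2 (Nat.cast_ne_zero.2 n.succ_ne_zero)
    obtain ⟨φ, hφ, h⟩ := h1.mul_analyticAt (analyticAt_id.inv hne)
    refine ⟨φ, hφ, ?_⟩
    have h2 : ∀ᶠ s : ℂ in 𝓝[≠] (-((n + 1 : ℕ) : ℂ)), s ≠ 0 :=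
      Eventually.filter_mono nhdsWithin_le_nhds (isOpen_ne.mem_nhds hne)
    filter_upwards [h, h2] with s hs hs0
    rw [← hs, Complex.Gamma_add_one s hs0]
    simp
    field_simp

/-! ### Growth of the Gamma function in vertical strips -/

theorem Complex.norm_Gamma_le_Gamma_re {s : ℂ} (hs : 0 < s.re) :
    ‖Complex.Gamma s‖ ≤ Real.Gamma s.re := by
  rw [Complex.Gamma_eq_integral hs, Real.Gamma_eq_integral hs, Complex.GammaIntegral]
  refine (norm_integral_le_integral_norm _).trans (le_of_eq ?_)
  refine setIntegral_congr_fun measurableSet_Ioi fun x hx => ?_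
  simp only [norm_mul, Complex.norm_real, Real.norm_eq_abs, Real.abs_exp]
  rw [Complex.norm_cpow_eq_rpow_re_of_pos hx]
  simp

/-- For positive real part, |Γ(s)| ≤ Γ(Re s). Strips further left are reached by dividing by s,
which has norm at least 1 there. Mere boundedness is enough, since the decay comes from the other
two Gamma factors. -/
theorem Complex.exists_norm_Gamma_le_of_strip (σ₁ σ₂ : ℝ) :
    ∃ C : ℝ, 0 ≤ C ∧ ∀ s : ℂ, σ₁ ≤ s.re → s.re ≤ σ₂ → 1 ≤ |s.im| → ‖Complex.Gamma s‖ ≤ C := by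
  obtain ⟨n, hn⟩ := exists_nat_gt (-σ₁)
  induction n generalizing σ₁ σ₂ with
  | zero =>
    have hσ : 0 < σ₁ := by simpa using hn
    obtain ⟨C, hC⟩ := isCompact_Icc.exists_bound_of_continuousOn (s := Icc σ₁ σ₂) (f := Real.Gamma)
      fun x hx => (Real.differentiableOn_Gamma_Ioi.differentiableAt
        (Ioi_mem_nhds (hσ.trans_le hx.1))).continuousAt.continuousWithinAt
    refine ⟨max C 0, le_max_right _ _, fun s h1 h2 _ => ?_⟩
    refine (Complex.norm_Gamma_le_Gamma_re (hσ.trans_le h1)).trans ?_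
    exact (le_abs_self _).trans ((hC s.re ⟨h1, h2⟩).trans (le_max_left _ _))
  | succ n ih =>
    obtain ⟨C, hC0, hC⟩ := ih (σ₁ + 1) (σ₂ + 1) (by push_cast at hn; linarith)
    refine ⟨C, hC0, fun s h1 h2 h3 => ?_⟩
    have hs1 : 1 ≤ ‖s‖ := h3.trans (Complex.abs_im_le_norm s)
    have hs0 : s ≠ 0 := by
      rintro rfl
      simp at hs1
      linarith
    have h4 := hC (s + 1) (by simpa using h1) (by simpa using h2) (by simpa using h3)
    rw [Complex.Gamma_add_one s hs0, norm_mul] at h4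
    nlinarith [norm_nonneg (Complex.Gamma s)]

theorem Complex.exp_abs_im_le_norm_sin {z : ℂ} (hz : 1 ≤ |z.im|) :
    Real.exp |z.im| ≤ 4 * ‖Complex.sin z‖ := by
  have key : ∀ z : ℂ, 1 ≤ z.im → Real.exp z.im ≤ 4 * ‖Complex.sin z‖ := by
    intro z hz
    have h1 : ‖Complex.exp (-z * Complex.I)‖ = Real.exp z.im := by
      rw [Complex.norm_exp]
      simp
    have h2 : ‖Complex.exp (z * Complex.I)‖ = Real.exp (-z.im) := by
      rw [Complex.norm_exp]
      simp
    have h3 : 2 * ‖Complex.sin z‖ = ‖Complex.exp (-z * Complex.I) - Complex.exp (z * Complex.I)‖ := by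
      rw [Complex.sin, norm_div, norm_mul, Complex.norm_I]
      norm_num
      ring
    have h4 := norm_sub_norm_le (Complex.exp (-z * Complex.I)) (Complex.exp (z * Complex.I))
    rw [← h3, h1, h2] at h4
    have h5 : 2 ≤ Real.exp z.im := by
      have := Real.add_one_le_exp z.im
      linarith
    have h6 : Real.exp (-z.im) ≤ 1 := Real.exp_le_one_iff.2 (by linarith)
    linarith
  rcases le_total 0 z.im with h | h
  · rw [abs_of_nonneg h] at hz ⊢
    exact key z hz
  · rw [abs_of_nonpos h] at hz ⊢
    have := key (-z) (by simpa using hz)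
    simpa [Complex.sin_neg] using this

/-- For a = 0 the reflection formula gives Γ(w)Γ(-w) = -π/(w sin πw). Each unit step in a costs one
factor a + w, of linear growth. -/
theorem exists_norm_Gamma_mul_Gamma_neg_le (a : ℕ) (σ₁ σ₂ : ℝ) :
    ∃ C : ℝ, 0 ≤ C ∧ ∀ w : ℂ, σ₁ ≤ w.re → w.re ≤ σ₂ → 1 ≤ |w.im| →
      ‖Complex.Gamma (a + w) * Complex.Gamma (-w)‖ ≤
        C * (1 + |w.im|) ^ a * Real.exp (-(Real.pi * |w.im|)) := by
  induction a with
  | zero =>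
    refine ⟨4 * Real.pi, by positivity, fun w _ _ h3 => ?_⟩
    have hw1 : 1 ≤ ‖w‖ := h3.trans (Complex.abs_im_le_norm w)
    have hw0 : w ≠ 0 := by
      rintro rfl
      simp at hw1
      linarith
    have h4 := Complex.Gamma_mul_Gamma_one_sub w
    have h5 := Complex.Gamma_add_one (-w) (neg_ne_zero.2 hw0)
    rw [show (1 : ℂ) - w = -w + 1 by ring, h5] at h4
    have h6 : (Real.pi * w : ℂ).im = Real.pi * w.im := by simp
    have hpi := Real.pi_gt_three
    have h8 : |Real.pi * w.im| = Real.pi * |w.im| := by rw [abs_mul, abs_of_pos Real.pi_pos]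
    have h7 := Complex.exp_abs_im_le_norm_sin (z := Real.pi * w) (by
      rw [h6, h8]
      nlinarith)
    rw [h6, h8] at h7
    have hsin : 0 < ‖Complex.sin (Real.pi * w)‖ := by
      have := Real.exp_pos (Real.pi * |w.im|)
      linarith
    have h9 := congrArg norm h4
    rw [norm_mul, norm_mul, norm_neg, norm_div, Complex.norm_real, Real.norm_eq_abs,
      abs_of_pos Real.pi_pos] at h9
    have h10 : ‖Complex.Gamma w‖ * ‖Complex.Gamma (-w)‖ ≤
        Real.pi / ‖Complex.sin (Real.pi * w)‖ := by
      rw [← h9]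
      have : 0 ≤ ‖Complex.Gamma w‖ * ‖Complex.Gamma (-w)‖ := by positivity
      nlinarith
    simp only [Nat.cast_zero, zero_add, pow_zero, mul_one, norm_mul]
    refine h10.trans ?_
    rw [Real.exp_neg, div_le_iff₀ hsin]
    have := Real.exp_pos (Real.pi * |w.im|)
    rw [mul_assoc, mul_assoc, mul_left_comm, mul_comm _ (‖_‖), ← div_eq_mul_inv]
    refine le_mul_of_one_le_right Real.pi_pos.le ?_
    rw [← mul_div_assoc, one_le_div this]
    exact h7
  | succ a ih =>
    obtain ⟨C, hC0, hC⟩ := ih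
    refine ⟨(a + |σ₁| + |σ₂| + 1) * C, by positivity, fun w h1 h2 h3 => ?_⟩
    have hne : (a : ℂ) + w ≠ 0 := by
      intro h
      have := congrArg Complex.im h
      simp at this
      simp [this] at h3
      linarith
    have h4 : ‖(a : ℂ) + w‖ ≤ (a + |σ₁| + |σ₂| + 1) * (1 + |w.im|) := by
      have h5 : |w.re| ≤ |σ₁| + |σ₂| := by
        rw [abs_le]
        constructor
        · linarith [neg_abs_le σ₁, abs_nonneg σ₂]
        · linarith [le_abs_self σ₂, abs_nonneg σ₁]
      calc ‖(a : ℂ) + w‖ ≤ ‖(a : ℂ)‖ + ‖w‖ := norm_add_le _ _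
        _ ≤ a + (|w.re| + |w.im|) := by
          gcongr
          · simp
          · exact Complex.norm_le_abs_re_add_abs_im w
        _ ≤ _ := by
          have : (0 : ℝ) ≤ a := Nat.cast_nonneg a
          nlinarith [abs_nonneg σ₁, abs_nonneg σ₂, abs_nonneg w.im,
            mul_nonneg (add_nonneg (add_nonneg this (abs_nonneg σ₁)) (abs_nonneg σ₂))
              (abs_nonneg w.im)]
    have h5 : Complex.Gamma (((a + 1 : ℕ) : ℂ) + w) = (a + w) * Complex.Gamma (a + w) := by
      rw [← Complex.Gamma_add_one _ hne]
      push_cast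
      ring_nf
    rw [h5, mul_assoc, norm_mul]
    calc _ ≤ ((a + |σ₁| + |σ₂| + 1) * (1 + |w.im|)) *
          (C * (1 + |w.im|) ^ a * Real.exp (-(Real.pi * |w.im|))) :=
        mul_le_mul h4 (hC w h1 h2 h3) (norm_nonneg _) (by positivity)
      _ = _ := by ring

/-- The power is absorbed by (1+v)^a ≤ a! e^{1+v}. As π > 2, a factor e^{-v} survives. -/
theorem exists_norm_Gamma_mul_Gamma_neg_le_exp (a : ℕ) (σ₁ σ₂ : ℝ) :
    ∃ C : ℝ, 0 ≤ C ∧ ∀ w : ℂ, σ₁ ≤ w.re → w.re ≤ σ₂ → 1 ≤ |w.im| →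
      ‖Complex.Gamma (a + w) * Complex.Gamma (-w)‖ ≤ C * Real.exp (-|w.im|) := by
  obtain ⟨C, hC0, hC⟩ := exists_norm_Gamma_mul_Gamma_neg_le a σ₁ σ₂
  refine ⟨C * (a.factorial * Real.exp 1), by positivity, fun w h1 h2 h3 => ?_⟩
  refine (hC w h1 h2 h3).trans ?_
  rw [mul_assoc, mul_assoc]
  refine mul_le_mul_of_nonneg_left ?_ hC0
  have h4 := Real.pow_div_factorial_le_exp (1 + |w.im|) (by positivity) a
  rw [div_le_iff₀ (by positivity)] at h4
  calc _ ≤ Real.exp (1 + |w.im|) * a.factorial * Real.exp (-(2 * |w.im|)) := by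
        gcongr
        nlinarith [Real.pi_gt_three]
    _ = _ := by
      rw [show -|w.im| = |w.im| + (-(2 * |w.im|)) by ring, Real.exp_add, Real.exp_add]
      ring

theorem integrable_of_norm_le_exp_neg_abs {F : ℝ → ℂ} (hF : Continuous F) {C T : ℝ}
    (h : ∀ v, T ≤ |v| → ‖F v‖ ≤ C * Real.exp (-|v|)) : Integrable F := by
  obtain ⟨D, hD⟩ := isCompact_Icc.exists_bound_of_continuousOn (s := Icc (-T) T) hF.continuousOn
  have hexp : Integrable fun v : ℝ => Real.exp (-|v|) := by
    refine (integrable_inv_one_add_sq.const_mul 2).mono' (by fun_prop)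
      (Eventually.of_forall fun v => ?_)
    rw [Real.norm_eq_abs, Real.abs_exp, Real.exp_neg, ← div_eq_mul_inv,
      inv_le_comm₀ (Real.exp_pos _) (by positivity), inv_div]
    have := Real.quadratic_le_exp_of_nonneg (abs_nonneg v)
    rw [sq_abs] at this
    linarith [abs_nonneg v]
  refine (hexp.const_mul (|C| + |D| * Real.exp |T|)).mono' hF.aestronglyMeasurable
    (Eventually.of_forall fun v => ?_)
  have he := Real.exp_pos (-|v|)
  rcases le_total T |v| with hv | hv
  · refine (h v hv).trans (mul_le_mul_of_nonneg_right ?_ he.le)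
    have : 0 ≤ |D| * Real.exp |T| := by positivity
    linarith [le_abs_self C]
  · refine (hD v (abs_le.1 hv)).trans ?_
    have h1 : 1 ≤ Real.exp |T| * Real.exp (-|v|) := by
      rw [← Real.exp_add]
      exact Real.one_le_exp (by linarith [le_abs_self T])
    have h2 : |D| ≤ |D| * (Real.exp |T| * Real.exp (-|v|)) := le_mul_of_one_le_right (abs_nonneg _) h1
    have h3 : 0 ≤ |C| * Real.exp (-|v|) := by positivity
    linarith [le_abs_self D]

/-! ### The integrand `Γ(a + s + t) Γ(-s - t) Γ(s) x^{-s}` -/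

/-- The kernel `Γ(a + s + t) Γ(-(s + t)) Γ(s) x^{-s}`. -/
def gammaTriple (a : ℕ) (x : ℝ) (t s : ℂ) : ℂ :=
  Complex.Gamma (a + (s + t)) * Complex.Gamma (-(s + t)) * Complex.Gamma s * (x : ℂ) ^ (-s)

/-- The poles of `Γ(a + s + t) Γ(s)`. -/
def tripleLeft (a : ℕ) (t : ℂ) : Set ℂ := {s | (∃ n : ℕ, s + t = -a - n) ∨ ∃ n : ℕ, s = -n}

/-- The poles of `Γ(-s - t)`. -/
def tripleRight (t : ℂ) : Set ℂ := {s | ∃ n : ℕ, s + t = n}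

theorem analyticAt_ofReal_cpow_neg {x : ℝ} (hx : 0 < x) (z : ℂ) :
    AnalyticAt ℂ (fun s : ℂ => (x : ℂ) ^ (-s)) z := by
  refine Differentiable.analyticAt (fun s => ?_) z
  exact (differentiableAt_id.neg).const_cpow (Or.inl (Complex.ofReal_ne_zero.2 hx.ne'))

theorem analyticAt_gammaTriple {a : ℕ} {x : ℝ} (hx : 0 < x) {t z : ℂ}
    (hz : z ∉ tripleLeft a t ∪ tripleRight t) : AnalyticAt ℂ (gammaTriple a x t) z := by
  simp only [tripleLeft, tripleRight, mem_union, mem_ofPred_eq, not_or, not_exists] at hz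
  obtain ⟨⟨h1, h2⟩, h3⟩ := hz
  have hadd : AnalyticAt ℂ (fun s : ℂ => s + t) z := analyticAt_id.add analyticAt_const
  refine AnalyticAt.mul (AnalyticAt.mul (AnalyticAt.mul ?_ ?_) ?_) (analyticAt_ofReal_cpow_neg hx z)
  · refine (Complex.analyticAt_Gamma fun n hn => h1 n ?_).comp (analyticAt_const.add hadd)
    linear_combination hn
  · refine (Complex.analyticAt_Gamma fun n hn => h3 n ?_).comp hadd.neg
    linear_combination -hn
  · exact Complex.analyticAt_Gamma h2

/-- No two Gamma factors share a pole. Those of Γ(a+s+t) have s+t ≤ -a < 0 and those of Γ(-s-t) have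
s+t ≥ 0; a pole of Γ(s) shared with either would make t an integer. -/
theorem exists_hasSimplePart_gammaTriple {a : ℕ} (ha : 1 ≤ a) {x : ℝ} (hx : 0 < x) {t z : ℂ}
    (ht : ∀ n : ℤ, t ≠ n) (hz : z ∈ tripleLeft a t ∪ tripleRight t) :
    ∃ ρ, HasSimplePart (gammaTriple a x t) ρ z := by
  have hadd : AnalyticAt ℂ (fun s : ℂ => s + t) z := analyticAt_id.add analyticAt_const
  have hpow := analyticAt_ofReal_cpow_neg hx z
  have g1 (h : ∀ n : ℕ, (a : ℂ) + (z + t) ≠ -n) :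
      AnalyticAt ℂ (fun s : ℂ => Complex.Gamma (a + (s + t))) z :=
    (Complex.analyticAt_Gamma h).comp_of_eq (analyticAt_const.add hadd) rfl
  have g2 (h : ∀ n : ℕ, -(z + t) ≠ -n) : AnalyticAt ℂ (fun s : ℂ => Complex.Gamma (-(s + t))) z :=
    (Complex.analyticAt_Gamma h).comp_of_eq hadd.neg rfl
  have g3 (h : ∀ n : ℕ, z ≠ -n) : AnalyticAt ℂ Complex.Gamma z := Complex.analyticAt_Gamma h
  refine AtMostSimplePole.exists_hasSimplePart ?_
  rcases hz with (⟨n, hn⟩ | ⟨n, hn⟩) | ⟨n, hn⟩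
  · have hp : AtMostSimplePole (fun s : ℂ => Complex.Gamma (a + (s + t))) z := by
      have := AtMostSimplePole.comp_add (f := Complex.Gamma) (z := z) (b := t + a) (by
        rw [show z + (t + a) = -(n : ℂ) by linear_combination hn]
        exact atMostSimplePole_Gamma n)
      convert this using 3
      ring
    have h2 : ∀ k : ℕ, -(z + t) ≠ -k := by
      intro k hk
      rw [hn] at hk
      have h3 : ((a + n + k : ℕ) : ℂ) = 0 := by
        push_cast
        linear_combination hk
      rw [Nat.cast_eq_zero] at h3
      omega
    have h3 : ∀ k : ℕ, z ≠ -k := by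
      rintro k rfl
      refine ht (k - a - n) ?_
      push_cast
      linear_combination hn
    convert hp.mul_analyticAt (((g2 h2).mul (g3 h3)).mul hpow) using 2 with s
    simp only [gammaTriple, Pi.mul_apply]
    ring
  · have h1 : ∀ k : ℕ, (a : ℂ) + (z + t) ≠ -k := by
      intro k hk
      refine ht (n - a - k) ?_
      push_cast
      linear_combination hk - hn
    have h2 : ∀ k : ℕ, -(z + t) ≠ -k := by
      intro k hk
      refine ht (k + n) ?_
      push_cast
      linear_combination -hk - hn
    have hp : AtMostSimplePole Complex.Gamma z := hn ▸ atMostSimplePole_Gamma n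
    convert hp.mul_analyticAt (((g1 h1).mul (g2 h2)).mul hpow) using 2 with s
    simp only [gammaTriple, Pi.mul_apply]
    ring
  · have h1 : ∀ k : ℕ, (a : ℂ) + (z + t) ≠ -k := by
      intro k hk
      rw [hn] at hk
      have h3 : ((a + n + k : ℕ) : ℂ) = 0 := by
        push_cast
        linear_combination hk
      rw [Nat.cast_eq_zero] at h3
      omega
    have h3 : ∀ k : ℕ, z ≠ -k := by
      rintro k rfl
      refine ht (k + n) ?_
      push_cast
      linear_combination hn
    have hp : AtMostSimplePole (fun s : ℂ => Complex.Gamma (-(s + t))) z := by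
      refine AtMostSimplePole.comp_add (f := fun s : ℂ => Complex.Gamma (-s)) ?_
      refine AtMostSimplePole.comp_neg (f := Complex.Gamma) ?_
      rw [hn]
      exact atMostSimplePole_Gamma n
    convert hp.mul_analyticAt (((g1 h1).mul (g3 h3)).mul hpow) using 2 with s
    simp only [gammaTriple, Pi.mul_apply]
    ring

theorem exists_norm_gammaTriple_le (a : ℕ) {x : ℝ} (hx : 0 < x) (t : ℂ) (σ₁ σ₂ : ℝ) :
    ∃ C : ℝ, ∀ s : ℂ, σ₁ ≤ s.re → s.re ≤ σ₂ → 1 + |t.im| ≤ |s.im| →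
      ‖gammaTriple a x t s‖ ≤ C * Real.exp (-|s.im|) := by
  obtain ⟨C₁, h10, h1⟩ := exists_norm_Gamma_mul_Gamma_neg_le_exp a (σ₁ + t.re) (σ₂ + t.re)
  obtain ⟨C₂, h20, h2⟩ := Complex.exists_norm_Gamma_le_of_strip σ₁ σ₂
  obtain ⟨C₃, h3⟩ := isCompact_Icc.exists_bound_of_continuousOn (s := Icc σ₁ σ₂)
    (f := fun u : ℝ => x ^ (-u)) (Continuous.continuousOn
      (Real.continuous_const_rpow hx.ne' |>.comp continuous_neg))
  refine ⟨C₁ * Real.exp |t.im| * C₂ * C₃, fun s hs1 hs2 hs => ?_⟩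
  have h4 : 1 ≤ |(s + t).im| := by
    have := abs_sub_abs_le_abs_sub s.im (-t.im)
    rw [abs_neg, sub_neg_eq_add] at this
    rw [Complex.add_im]
    linarith
  have h5 : |s.im| ≤ |t.im| + |(s + t).im| := by
    have := abs_sub_abs_le_abs_sub s.im (-t.im)
    rw [abs_neg, sub_neg_eq_add] at this
    rw [Complex.add_im]
    linarith
  have h6 := h1 (s + t) (by simpa using hs1) (by simpa using hs2) h4
  have h7 := h2 s hs1 hs2 (by linarith [abs_nonneg t.im])
  have h8 : ‖(x : ℂ) ^ (-s)‖ ≤ C₃ := by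
    rw [Complex.norm_cpow_eq_rpow_re_of_pos hx, Complex.neg_re]
    exact (le_abs_self _).trans (h3 s.re ⟨hs1, hs2⟩)
  rw [gammaTriple, norm_mul, norm_mul]
  calc _ ≤ C₁ * Real.exp (-|(s + t).im|) * C₂ * C₃ := by gcongr
    _ ≤ C₁ * (Real.exp |t.im| * Real.exp (-|s.im|)) * C₂ * C₃ := by
      have : 0 ≤ C₃ := (norm_nonneg _).trans h8
      gcongr
      rw [← Real.exp_add, Real.exp_le_exp]
      linarith
    _ = _ := by ring

theorem tendsto_gammaTriple_stripInfty (a : ℕ) {x : ℝ} (hx : 0 < x) (t : ℂ) (σ₁ σ₂ : ℝ) :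
    Tendsto (gammaTriple a x t) (stripInfty σ₁ σ₂) (𝓝 0) := by
  obtain ⟨C, hC⟩ := exists_norm_gammaTriple_le a hx t σ₁ σ₂
  have him : Tendsto (fun s : ℂ => |s.im|) (stripInfty σ₁ σ₂) atTop :=
    tendsto_comap.mono_left inf_le_left
  have h4 : ∀ᶠ s : ℂ in stripInfty σ₁ σ₂, σ₁ ≤ s.re ∧ s.re ≤ σ₂ :=
    Eventually.filter_mono inf_le_right (mem_principal_self _)
  refine squeeze_zero_norm' (a := fun s : ℂ => C * Real.exp (-|s.im|)) ?_ ?_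
  · filter_upwards [him.eventually_ge_atTop (1 + |t.im|), h4] with s hs hs'
    exact hC s hs'.1 hs'.2 hs
  · have := (Real.tendsto_exp_neg_atTop_nhds_zero.comp him).const_mul C
    simpa using this

theorem integrable_gammaTriple_line (a : ℕ) {x : ℝ} (hx : 0 < x) (t : ℂ) {σ : ℝ}
    (hσ : ∀ z ∈ tripleLeft a t ∪ tripleRight t, z.re ≠ σ) :
    Integrable fun v : ℝ => gammaTriple a x t (σ + v * Complex.I) := by
  obtain ⟨C, hC⟩ := exists_norm_gammaTriple_le a hx t σ σ
  refine integrable_of_norm_le_exp_neg_abs (C := C) (T := 1 + |t.im|) ?_ fun v hv => ?_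
  · refine continuous_iff_continuousAt.2 fun v => ?_
    have h1 : ContinuousAt (gammaTriple a x t) (σ + v * Complex.I) :=
      (analyticAt_gammaTriple hx fun hz => hσ _ hz (by simp)).continuousAt
    exact ContinuousAt.comp (f := fun v : ℝ => (σ : ℂ) + v * Complex.I) h1 (by fun_prop)
  · simpa using hC (σ + v * Complex.I) (by simp) (by simp) (by simpa using hv)

/-- Independence of the contour for the integral of `Γ(a + s + t) Γ(-s - t) Γ(s) x^{-s}`. -/
theorem integral_gammaTriple_eq {a : ℕ} (ha : 1 ≤ a) {x : ℝ} (hx : 0 < x) {t : ℂ}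
    (ht : ∀ n : ℤ, t ≠ n) {L₁ L₂ : Meijer.Contour}
    (h₁ : L₁.Separates (tripleLeft a t) (tripleRight t))
    (h₂ : L₂.Separates (tripleLeft a t) (tripleRight t)) :
    L₁.integral (gammaTriple a x t) = L₂.integral (gammaTriple a x t) := by
  have hex : ∀ z, ∃ ρ, z ∈ tripleLeft a t ∪ tripleRight t →
      HasSimplePart (gammaTriple a x t) ρ z := by
    intro z
    by_cases hz : z ∈ tripleLeft a t ∪ tripleRight t
    · obtain ⟨ρ, h⟩ := exists_hasSimplePart_gammaTriple ha hx ht hz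
      exact ⟨ρ, fun _ => h⟩
    · exact ⟨0, fun h => absurd h hz⟩
  choose ρ hρ using hex
  exact Meijer.Contour.integral_eq_integral hρ (fun z hz => analyticAt_gammaTriple hx hz)
    (tendsto_gammaTriple_stripInfty a hx t) h₁ h₂
    (integrable_gammaTriple_line a hx t h₁.off_line)
    (integrable_gammaTriple_line a hx t h₂.off_line)

/-! ### Mellin transforms -/

theorem ofReal_mul_cpow_exp_norm {u : ℝ} (hu : 0 < u) (s : ℂ) (r : ℝ) :
    ‖(u : ℂ) ^ s * Complex.exp (-(r * u))‖ = u ^ s.re * Real.exp (-(r * u)) := by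
  rw [norm_mul, Complex.norm_cpow_eq_rpow_re_of_pos hu, Complex.norm_exp]
  simp

theorem integrableOn_cpow_mul_exp_neg_mul {s : ℂ} (hs : 0 < s.re) {r : ℝ} (hr : 0 < r) :
    IntegrableOn (fun u : ℝ => (u : ℂ) ^ (s - 1) * Complex.exp (-(r * u))) (Ioi 0) := by
  -- A divergent Bochner integral has the value 0, whereas the closed form does not vanish.
  by_contra h
  have h1 := Complex.integral_cpow_mul_exp_neg_mul_Ioi hs hr
  rw [integral_undef h] at h1
  have h2 : (1 / (r : ℂ)) ^ s ≠ 0 := by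
    rw [Ne, Complex.cpow_eq_zero_iff]
    simp [hr.ne']
  exact mul_ne_zero h2 (Complex.Gamma_ne_zero_of_re_pos hs) h1.symm

theorem integral_pow_mul_exp_neg_mul (b : ℕ) {r : ℝ} (hr : 0 < r) :
    ∫ x in Ioi (0 : ℝ), x ^ b * Real.exp (-(r * x)) = b.factorial * (r ^ (b + 1))⁻¹ := by
  have h := Real.integral_rpow_mul_exp_neg_mul_Ioi (a := b + 1) (r := r) (by positivity) hr
  rw [Real.Gamma_nat_eq_factorial, show ((b : ℝ) + 1) = ((b + 1 : ℕ) : ℝ) by push_cast; rfl,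
    Real.rpow_natCast] at h
  rw [mul_comm, ← inv_pow, ← one_div, ← h]
  refine setIntegral_congr_fun measurableSet_Ioi fun x _ => ?_
  simp

theorem integrableOn_pow_mul_exp_neg_mul (b : ℕ) {r : ℝ} (hr : 0 < r) :
    IntegrableOn (fun x : ℝ => x ^ b * Real.exp (-(r * x))) (Ioi 0) := by
  by_contra h
  have h1 := integral_pow_mul_exp_neg_mul b hr
  rw [integral_undef h] at h1
  have : (0 : ℝ) < b.factorial * (r ^ (b + 1))⁻¹ := by positivity
  exact this.ne h1

theorem integral_pow_mul_exp_neg_mul_complex (b : ℕ) {r : ℝ} (hr : 0 < r) :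
    ∫ x in Ioi (0 : ℝ), ((x ^ b * Real.exp (-(r * x)) : ℝ) : ℂ) =
      ((b.factorial * (r ^ (b + 1))⁻¹ : ℝ) : ℂ) := by
  rw [integral_complex_ofReal, integral_pow_mul_exp_neg_mul b hr]

/-- Two evaluations of `∫∫ u^{s-1} x^b e^{-x} e^{-u(x+κ)} dx du`. -/
theorem Gamma_mul_integral_add_cpow (b : ℕ) {κ : ℝ} (hκ : 0 ≤ κ) {s : ℂ} (hs : 0 < s.re)
    (hint : IntegrableOn (fun u : ℝ => u ^ (s.re - 1) * ((1 + u) ^ (b + 1))⁻¹ *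
      Real.exp (-(κ * u))) (Ioi 0)) :
    Complex.Gamma s * ∫ x in Ioi (0 : ℝ), ((x ^ b * Real.exp (-x) : ℝ) : ℂ) * ((x + κ : ℝ) : ℂ) ^ (-s) =
      b.factorial * ∫ u in Ioi (0 : ℝ), (u : ℂ) ^ (s - 1) *
        (((1 + u) ^ (b + 1))⁻¹ * Real.exp (-(κ * u)) : ℝ) := by
  set F : ℝ → ℝ → ℂ := fun x u => (u : ℂ) ^ (s - 1) *
    ((Real.exp (-(κ * u)) * (x ^ b * Real.exp (-((1 + u) * x))) : ℝ) : ℂ) with hF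
  have hmeas : Measurable (Function.uncurry F) := by
    simp only [hF, Function.uncurry_def]
    fun_prop
  have hint2 : Integrable (Function.uncurry F)
      ((volume.restrict (Ioi (0 : ℝ))).prod (volume.restrict (Ioi (0 : ℝ)))) := by
    -- Integrating the norm over x first is explicit and leads to the hypothesis `hint`.
    rw [integrable_prod_iff' hmeas.aestronglyMeasurable]
    constructor
    · filter_upwards [ae_restrict_mem measurableSet_Ioi] with u hu
      have hu' : (0 : ℝ) < 1 + u := by linarith [mem_Ioi.1 hu]
      have h : Integrable (fun x : ℝ => ((Real.exp (-(κ * u)) *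
          (x ^ b * Real.exp (-((1 + u) * x))) : ℝ) : ℂ)) (volume.restrict (Ioi 0)) :=
        ((integrableOn_pow_mul_exp_neg_mul b hu').const_mul _).ofReal
      exact h.const_mul ((u : ℂ) ^ (s - 1))
    · refine (hint.const_mul (b.factorial : ℝ)).congr ?_
      filter_upwards [ae_restrict_mem measurableSet_Ioi] with u hu
      have hu' : (0 : ℝ) < 1 + u := by linarith [mem_Ioi.1 hu]
      have h1 : ∀ x ∈ Ioi (0 : ℝ), ‖Function.uncurry F (x, u)‖ =
          u ^ (s.re - 1) * Real.exp (-(κ * u)) * (x ^ b * Real.exp (-((1 + u) * x))) := by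
        intro x hx
        have hx' : (0 : ℝ) < x := hx
        simp only [Function.uncurry_apply_pair, hF]
        rw [norm_mul, Complex.norm_cpow_eq_rpow_re_of_pos hu, Complex.norm_real, Real.norm_eq_abs,
          abs_of_pos (by positivity)]
        simp
        ring
      rw [setIntegral_congr_fun measurableSet_Ioi h1, integral_const_mul,
        integral_pow_mul_exp_neg_mul b hu']
      ring
  -- Integration over u first gives Γ(s)(x+κ)^{-s}; over x first it gives b!/(1+u)^{b+1}.
  have hswap := integral_integral_swap hint2
  have hL : ∫ x in Ioi (0 : ℝ), ∫ u in Ioi (0 : ℝ), F x u = Complex.Gamma s *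
      ∫ x in Ioi (0 : ℝ), ((x ^ b * Real.exp (-x) : ℝ) : ℂ) * ((x + κ : ℝ) : ℂ) ^ (-s) := by
    rw [← integral_const_mul]
    refine setIntegral_congr_fun measurableSet_Ioi fun x hx => ?_
    have hx' : (0 : ℝ) < x := hx
    have hr : 0 < x + κ := by linarith
    have h1 : ∀ u ∈ Ioi (0 : ℝ), F x u = ((x ^ b * Real.exp (-x) : ℝ) : ℂ) *
        ((u : ℂ) ^ (s - 1) * Complex.exp (-(((x + κ : ℝ) : ℂ) * u))) := by
      intro u _
      have h2 : Real.exp (-(κ * u)) * (x ^ b * Real.exp (-((1 + u) * x))) =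
          x ^ b * Real.exp (-x) * Real.exp (-((x + κ) * u)) := by
        rw [mul_left_comm, mul_assoc, ← Real.exp_add, ← Real.exp_add]
        ring_nf
      simp only [hF, h2]
      push_cast
      ring
    rw [setIntegral_congr_fun measurableSet_Ioi h1, integral_const_mul,
      Complex.integral_cpow_mul_exp_neg_mul_Ioi hs hr, one_div, Complex.inv_cpow,
      Complex.cpow_neg]
    · ring
    · rw [Complex.arg_ofReal_of_nonneg hr.le]
      exact Real.pi_pos.ne
  have hR : ∫ u in Ioi (0 : ℝ), ∫ x in Ioi (0 : ℝ), F x u =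
      b.factorial * ∫ u in Ioi (0 : ℝ), (u : ℂ) ^ (s - 1) *
        (((1 + u) ^ (b + 1))⁻¹ * Real.exp (-(κ * u)) : ℝ) := by
    rw [← integral_const_mul]
    refine setIntegral_congr_fun measurableSet_Ioi fun u hu => ?_
    have hu' : (0 : ℝ) < 1 + u := by linarith [mem_Ioi.1 hu]
    have h1 : ∀ x : ℝ, F x u = ((u : ℂ) ^ (s - 1) * (Real.exp (-(κ * u)) : ℝ)) *
        ((x ^ b * Real.exp (-((1 + u) * x)) : ℝ) : ℂ) := by
      intro x
      simp only [hF]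
      push_cast
      ring
    simp only [h1]
    rw [integral_const_mul, integral_pow_mul_exp_neg_mul_complex b hu']
    push_cast
    ring
  rw [← hL, ← hR, hswap]

theorem mellinConvergent_inv_one_add_pow (b : ℕ) {s : ℂ} (hs : 0 < s.re) (hs' : s.re < b + 1) :
    MellinConvergent (fun u : ℝ => ((((1 + u) ^ (b + 1))⁻¹ : ℝ) : ℂ)) s := by
  refine mellinConvergent_of_isBigO_rpow (a := b + 1) (b := 0) ?_ ?_ hs' ?_ hs
  · refine ContinuousOn.locallyIntegrableOn ?_ measurableSet_Ioi
    refine Complex.continuous_ofReal.comp_continuousOn (ContinuousOn.inv₀ (by fun_prop) ?_)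
    intro u hu
    have : (0 : ℝ) < 1 + u := by linarith [mem_Ioi.1 hu]
    positivity
  · refine Asymptotics.IsBigO.of_bound 1 ?_
    filter_upwards [eventually_gt_atTop 0] with u hu
    rw [Complex.norm_real, Real.norm_eq_abs, Real.norm_eq_abs, abs_of_pos (by positivity),
      abs_of_pos (by positivity), one_mul, Real.rpow_neg hu.le,
      show ((b : ℝ) + 1) = ((b + 1 : ℕ) : ℝ) by push_cast; rfl, Real.rpow_natCast]
    gcongr
    linarith
  · refine Asymptotics.IsBigO.of_bound 1 ?_
    filter_upwards [self_mem_nhdsWithin] with u hu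
    have : (0 : ℝ) < u := hu
    rw [Complex.norm_real, Real.norm_eq_abs, Real.norm_eq_abs, abs_of_pos (by positivity),
      abs_of_pos (by positivity)]
    simp only [neg_zero, Real.rpow_zero, mul_one]
    exact inv_le_one_of_one_le₀ (one_le_pow₀ (by linarith))

/-- The case κ = 0 of the double integral, where the remaining x-integral is Γ(b+1-s). -/
theorem mellin_inv_one_add_pow (b : ℕ) {s : ℂ} (hs : 0 < s.re) (hs' : s.re < b + 1) :
    mellin (fun u : ℝ => ((((1 + u) ^ (b + 1))⁻¹ : ℝ) : ℂ)) s =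
      Complex.Gamma s * Complex.Gamma (b + 1 - s) / b.factorial := by
  have hconv := mellinConvergent_inv_one_add_pow b hs hs'
  have hint : IntegrableOn (fun u : ℝ => u ^ (s.re - 1) * ((1 + u) ^ (b + 1))⁻¹ *
      Real.exp (-((0 : ℝ) * u))) (Ioi 0) := by
    refine hconv.norm.congr ?_
    filter_upwards [ae_restrict_mem measurableSet_Ioi] with u hu
    have hu' : (0 : ℝ) < u := hu
    rw [norm_smul, Complex.norm_cpow_eq_rpow_re_of_pos hu, Complex.norm_real, Real.norm_eq_abs,
      abs_of_pos (by positivity)]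
    simp
  have h := Gamma_mul_integral_add_cpow b le_rfl hs hint
  have h1 : ∫ x in Ioi (0 : ℝ), ((x ^ b * Real.exp (-x) : ℝ) : ℂ) * ((x + (0 : ℝ) : ℝ) : ℂ) ^ (-s) =
      Complex.Gamma (b + 1 - s) := by
    rw [Complex.Gamma_eq_integral (by simp; linarith), Complex.GammaIntegral]
    refine setIntegral_congr_fun measurableSet_Ioi fun x hx => ?_
    have hx' : (x : ℂ) ≠ 0 := Complex.ofReal_ne_zero.2 (ne_of_gt hx)
    simp only [add_zero]
    rw [show ((b : ℂ) + 1 - s - 1) = (b : ℂ) + (-s) by ring, Complex.cpow_add _ _ hx',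
      Complex.cpow_natCast]
    push_cast
    ring
  have h2 : ∫ u in Ioi (0 : ℝ), (u : ℂ) ^ (s - 1) *
        (((1 + u) ^ (b + 1))⁻¹ * Real.exp (-((0 : ℝ) * u)) : ℝ) =
      mellin (fun u : ℝ => ((((1 + u) ^ (b + 1))⁻¹ : ℝ) : ℂ)) s := by
    rw [mellin]
    simp
  rw [h1, h2] at h
  have : (b.factorial : ℂ) ≠ 0 := Nat.cast_ne_zero.2 b.factorial_ne_zero
  rw [h]
  field_simp

/-- Subadditivity of u ↦ u^ε and log v ≤ v - 1. One family of bounds serves both ends of the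
half-line: ε = 1 near 0, small ε at infinity. -/
theorem Real.log_one_add_le_rpow {u ε : ℝ} (hu : 0 ≤ u) (hε : 0 < ε) (hε' : ε ≤ 1) :
    Real.log (1 + u) ≤ u ^ ε / ε := by
  rw [le_div_iff₀ hε, mul_comm, ← Real.log_rpow (by linarith)]
  have h1 : (1 + u) ^ ε ≤ 1 + u ^ ε := by
    have := Real.rpow_add_le_add_rpow zero_le_one hu hε.le hε'
    simpa using this
  calc _ ≤ Real.log (1 + u ^ ε) := Real.log_le_log (by positivity) h1
    _ ≤ _ := by
      have := Real.log_le_sub_one_of_pos (x := 1 + u ^ ε) (by positivity)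
      linarith

theorem norm_log_one_add_le {u ε : ℝ} (hu : 0 < u) (hε : 0 < ε) (hε' : ε ≤ 1) :
    ‖((Real.log (1 + u) : ℝ) : ℂ)‖ ≤ u ^ ε / ε := by
  rw [Complex.norm_real, Real.norm_eq_abs, abs_of_nonneg (Real.log_nonneg (by linarith))]
  exact Real.log_one_add_le_rpow hu.le hε hε'

theorem mellinConvergent_log_one_add {s : ℂ} (hs : -1 < s.re) (hs' : s.re < 0) :
    MellinConvergent (fun u : ℝ => ((Real.log (1 + u) : ℝ) : ℂ)) s := by
  have hb : ∀ ε : ℝ, 0 < ε → ε ≤ 1 → ∀ u : ℝ, 0 < u →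
      ‖((Real.log (1 + u) : ℝ) : ℂ)‖ ≤ 1 / ε * ‖u ^ (-(-ε))‖ := by
    intro ε h1 h2 u hu
    rw [neg_neg, Real.norm_eq_abs, abs_of_pos (by positivity)]
    refine (norm_log_one_add_le hu h1 h2).trans (le_of_eq (by ring))
  refine mellinConvergent_of_isBigO_rpow (a := -(-s.re / 2)) (b := -1) ?_ ?_ ?_ ?_ hs
  · refine ContinuousOn.locallyIntegrableOn ?_ measurableSet_Ioi
    refine Complex.continuous_ofReal.comp_continuousOn (ContinuousOn.log (by fun_prop) ?_)
    intro u hu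
    have : (0 : ℝ) < 1 + u := by linarith [mem_Ioi.1 hu]
    exact this.ne'
  · refine Asymptotics.IsBigO.of_bound (1 / (-s.re / 2)) ?_
    filter_upwards [eventually_gt_atTop 0] with u hu
    exact hb _ (by linarith) (by linarith) u hu
  · linarith
  · refine Asymptotics.IsBigO.of_bound (1 / 1) ?_
    filter_upwards [self_mem_nhdsWithin] with u hu
    exact hb 1 one_pos le_rfl u hu

/-- Integration by parts against u^s/s replaces the logarithm by 1/(1+u), with Mellin variable s +
1. The boundary terms vanish by the bounds with ε = 1 at 0 and ε = -Re s/2 at infinity. -/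
theorem mellin_log_one_add {s : ℂ} (hs : -1 < s.re) (hs' : s.re < 0) :
    mellin (fun u : ℝ => ((Real.log (1 + u) : ℝ) : ℂ)) s =
      Complex.Gamma (1 + s) * Complex.Gamma (-s) / (-s) := by
  have hs0 : s ≠ 0 := by
    rintro rfl
    simp at hs'
  have hconv := mellinConvergent_log_one_add hs hs'
  have hre1 : 0 < (s + 1).re := by
    simp
    linarith
  have hre2 : (s + 1).re < (0 : ℕ) + 1 := by
    simp
    linarith
  have hconv1 := mellinConvergent_inv_one_add_pow 0 hre1 hre2
  have hval1 := mellin_inv_one_add_pow 0 hre1 hre2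
  have hbd : ∀ ε : ℝ, 0 < ε → ε ≤ 1 → ∀ u : ℝ, 0 < u →
      ‖((Real.log (1 + u) : ℝ) : ℂ) * ((u : ℂ) ^ s / s)‖ ≤ 1 / (ε * ‖s‖) * u ^ (ε + s.re) := by
    intro ε h1 h2 u hu
    rw [norm_mul, norm_div, Complex.norm_cpow_eq_rpow_re_of_pos hu, Real.rpow_add hu]
    have hsn : 0 < ‖s‖ := norm_pos_iff.2 hs0
    calc _ ≤ u ^ ε / ε * (u ^ s.re / ‖s‖) := by
          gcongr
          exact norm_log_one_add_le hu h1 h2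
      _ = _ := by
        field_simp
  have hparts := integral_Ioi_mul_deriv_eq_deriv_mul (a := (0 : ℝ)) (A := ℂ) (a' := 0) (b' := 0)
    (u := fun u : ℝ => ((Real.log (1 + u) : ℝ) : ℂ)) (v := fun u : ℝ => (u : ℂ) ^ s / s)
    (u' := fun u : ℝ => (((1 + u)⁻¹ : ℝ) : ℂ)) (v' := fun u : ℝ => (u : ℂ) ^ (s - 1)) ?_ ?_ ?_ ?_ ?_ ?_
  · have h1 : mellin (fun u : ℝ => ((Real.log (1 + u) : ℝ) : ℂ)) s =
        ∫ u in Ioi (0 : ℝ), ((Real.log (1 + u) : ℝ) : ℂ) * (u : ℂ) ^ (s - 1) := by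
      rw [mellin]
      simp only [smul_eq_mul, mul_comm]
    have h2 : ∫ u in Ioi (0 : ℝ), (((1 + u)⁻¹ : ℝ) : ℂ) * ((u : ℂ) ^ s / s) =
        (mellin (fun u : ℝ => ((((1 + u) ^ (0 + 1))⁻¹ : ℝ) : ℂ)) (s + 1)) / s := by
      rw [mellin, ← integral_div]
      refine setIntegral_congr_fun measurableSet_Ioi fun u _ => ?_
      simp
      ring
    rw [h1, hparts, h2, hval1]
    simp
    rw [add_comm s 1]
    ring
  · intro u hu
    have hu' : (1 : ℝ) + u ≠ 0 := by linarith [mem_Ioi.1 hu] |> fun h : 0 < 1 + u => h.ne'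
    have := ((hasDerivAt_id u).const_add 1).log hu'
    simpa using this.ofReal_comp
  · intro u hu
    have := hasDerivAt_ofReal_cpow_const' (ne_of_gt (mem_Ioi.1 hu)) (r := s - 1) (by
      intro h
      exact hs0 (by linear_combination h))
    simpa using this
  · refine hconv.congr (Eventually.of_forall fun u => ?_)
    simp [mul_comm]
  · refine (hconv1.div_const s).congr (Eventually.of_forall fun u => ?_)
    simp
    ring
  · refine squeeze_zero_norm' (a := fun u : ℝ => 1 / (1 * ‖s‖) * u ^ (1 + s.re)) ?_ ?_
    · filter_upwards [self_mem_nhdsWithin] with u hu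
      exact hbd 1 one_pos le_rfl u hu
    · have h1 : Tendsto (fun u : ℝ => u ^ (1 + s.re)) (𝓝[>] 0) (𝓝 0) := by
        have := (Real.continuousAt_rpow_const 0 (1 + s.re) (Or.inr (by linarith))).tendsto
        rw [Real.zero_rpow (by linarith)] at this
        exact this.mono_left nhdsWithin_le_nhds
      simpa using h1.const_mul (1 / (1 * ‖s‖))
  · refine squeeze_zero_norm' (a := fun u : ℝ => 1 / (-s.re / 2 * ‖s‖) * u ^ (-s.re / 2 + s.re)) ?_ ?_
    · filter_upwards [eventually_gt_atTop 0] with u hu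
      exact hbd (-s.re / 2) (by linarith) (by linarith) u hu
    · have h1 : Tendsto (fun u : ℝ => u ^ (-s.re / 2 + s.re)) atTop (𝓝 0) := by
        have := tendsto_rpow_neg_atTop (y := -s.re / 2) (by linarith)
        convert this using 3
        ring
      simpa using h1.const_mul (1 / (-s.re / 2 * ‖s‖))

/-- Mellin inversion, in the variable `w = -s`. -/
theorem integral_cpow_mul_mellin_neg {q : ℝ → ℂ} {Q : ℂ → ℂ} {δ : ℝ}
    (hQ : ∀ w : ℂ, w.re = δ → mellin q (-w) = Q w) (hconv : MellinConvergent q ((-δ : ℝ) : ℂ))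
    (hint : Integrable fun v : ℝ => Q (δ + v * Complex.I)) {u : ℝ} (hu : 0 < u)
    (hq : ContinuousAt q u) :
    ∫ v : ℝ, (u : ℂ) ^ ((δ : ℂ) + v * Complex.I) * Q (δ + v * Complex.I) = 2 * Real.pi * q u := by
  have hline : ∀ v : ℝ, mellin q (((-δ : ℝ) : ℂ) + (v : ℂ) * Complex.I) =
      Q (δ + ((-v : ℝ) : ℂ) * Complex.I) := by
    intro v
    rw [← hQ _ (by simp)]
    congr 1
    push_cast
    ring
  have hvert : Complex.VerticalIntegrable (mellin q) (-δ) := by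
    refine (hint.comp_neg).congr (Eventually.of_forall fun v => ?_)
    exact (hline v).symm
  have h := mellinInv_mellin_eq (-δ) q hu hconv hvert hq
  rw [mellinInv] at h
  simp only [hline] at h
  rw [← integral_neg_eq_self, ← h, Complex.real_smul]
  simp only [smul_eq_mul]
  have hpi : (Real.pi : ℂ) ≠ 0 := Complex.ofReal_ne_zero.2 Real.pi_ne_zero
  have h2 : ∫ v : ℝ, (u : ℂ) ^ ((δ : ℂ) + ((-v : ℝ) : ℂ) * Complex.I) *
      Q (δ + ((-v : ℝ) : ℂ) * Complex.I) = ∫ v : ℝ, (u : ℂ) ^ (-(((-δ : ℝ) : ℂ) + v * Complex.I)) *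
      Q (δ + ((-v : ℝ) : ℂ) * Complex.I) := by
    congr 1
    ext v
    congr 2
    push_cast
    ring
  rw [h2]
  generalize (∫ v : ℝ, (u : ℂ) ^ (-(((-δ : ℝ) : ℂ) + v * Complex.I)) *
    Q (δ + ((-v : ℝ) : ℂ) * Complex.I)) = J
  push_cast
  field_simp

/-- A Parseval formula for the product of a Mellin transform with the Gamma function. -/
theorem integral_mellin_mul_Gamma {q : ℝ → ℂ} {Q : ℂ → ℂ} {σ : ℝ} {t : ℂ} (hσ : 0 < σ)
    (hQ : ∀ w : ℂ, w.re = σ + t.re → mellin q (-w) = Q w)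
    (hconv : MellinConvergent q ((-(σ + t.re) : ℝ) : ℂ))
    (hint : Integrable fun v : ℝ => Q ((σ + t.re : ℝ) + v * Complex.I))
    (hq : ∀ u : ℝ, 0 < u → ContinuousAt q u) {x : ℝ} (hx : 0 < x) :
    ∫ v : ℝ, Q ((σ : ℂ) + v * Complex.I + t) * Complex.Gamma (σ + v * Complex.I) *
        (x : ℂ) ^ (-((σ : ℂ) + v * Complex.I)) =
      2 * Real.pi * ∫ u in Ioi (0 : ℝ), (u : ℂ) ^ (-t - 1) * (q u * Complex.exp (-(x * u))) := by
  have hline : ∀ v : ℝ, (σ : ℂ) + v * Complex.I + t =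
      ((σ + t.re : ℝ) : ℂ) + ((v + t.im : ℝ) : ℂ) * Complex.I := by
    intro v
    apply Complex.ext <;> simp
  have hint' : Integrable fun v : ℝ => Q ((σ : ℂ) + v * Complex.I + t) := by
    simp only [hline]
    exact hint.comp_add_right t.im
  -- Γ(s)x^{-s} is expanded as ∫ u^{s-1} e^{-xu} du. After the interchange, the v-integral is the
  -- Mellin inversion of q at u.
  set F : ℝ → ℝ → ℂ := fun v u => Q ((σ : ℂ) + v * Complex.I + t) *
    ((u : ℂ) ^ ((σ : ℂ) + v * Complex.I - 1) * Complex.exp (-(x * u))) with hF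
  have hint2 : Integrable (Function.uncurry F) (volume.prod (volume.restrict (Ioi (0 : ℝ)))) := by
    have hG := integrableOn_cpow_mul_exp_neg_mul (s := (σ : ℂ)) (by simpa using hσ) hx
    refine (hint'.norm.mul_prod hG.norm).mono' ?_ ?_
    · refine hint'.aestronglyMeasurable.comp_fst.mul (Measurable.aestronglyMeasurable ?_)
      fun_prop
    · have : ∀ᵐ p : ℝ × ℝ ∂(volume.prod (volume.restrict (Ioi (0 : ℝ)))), p.2 ∈ Ioi (0 : ℝ) :=
        Measure.quasiMeasurePreserving_snd.ae (ae_restrict_mem measurableSet_Ioi)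
      filter_upwards [this] with p hp
      simp only [Function.uncurry_def, hF]
      rw [norm_mul, ofReal_mul_cpow_exp_norm hp, ofReal_mul_cpow_exp_norm hp]
      simp
  have hswap := integral_integral_swap hint2
  have hL : ∀ v : ℝ, ∫ u in Ioi (0 : ℝ), F v u = Q ((σ : ℂ) + v * Complex.I + t) *
      Complex.Gamma (σ + v * Complex.I) * (x : ℂ) ^ (-((σ : ℂ) + v * Complex.I)) := by
    intro v
    simp only [hF]
    rw [integral_const_mul, Complex.integral_cpow_mul_exp_neg_mul_Ioi (by simpa using hσ) hx,
      one_div, Complex.inv_cpow, Complex.cpow_neg]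
    · ring
    · rw [Complex.arg_ofReal_of_nonneg hx.le]
      exact Real.pi_pos.ne
  simp only [hL] at hswap
  rw [hswap, ← integral_const_mul]
  refine setIntegral_congr_fun measurableSet_Ioi fun u hu => ?_
  have hu0 : (u : ℂ) ≠ 0 := Complex.ofReal_ne_zero.2 (ne_of_gt hu)
  have h1 : ∀ v : ℝ, F v u = ((u : ℂ) ^ (-t - 1) * Complex.exp (-(x * u))) *
      ((u : ℂ) ^ (((σ + t.re : ℝ) : ℂ) + ((v + t.im : ℝ) : ℂ) * Complex.I) *
        Q (((σ + t.re : ℝ) : ℂ) + ((v + t.im : ℝ) : ℂ) * Complex.I)) := by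
    intro v
    simp only [hF]
    rw [← hline, show (σ : ℂ) + v * Complex.I - 1 = (-t - 1) + (σ + v * Complex.I + t) by ring,
      Complex.cpow_add _ _ hu0]
    ring
  simp only [h1]
  rw [integral_const_mul, integral_add_right_eq_self
    (fun v : ℝ => (u : ℂ) ^ (((σ + t.re : ℝ) : ℂ) + (v : ℂ) * Complex.I) *
        Q (((σ + t.re : ℝ) : ℂ) + (v : ℂ) * Complex.I)) t.im,
    integral_cpow_mul_mellin_neg hQ hconv hint hu (hq u hu)]
  ring

/-! ### The value of the inner integral -/

/-- The integral `∫₀^∞ x^b e^{-x} (x + κ)^t dx`. -/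
def shiftedGamma (b : ℕ) (κ : ℝ) (t : ℂ) : ℂ :=
  ∫ x in Ioi (0 : ℝ), ((x ^ b * Real.exp (-x) : ℝ) : ℂ) * ((x + κ : ℝ) : ℂ) ^ t

theorem integrableOn_pow_mul_exp_mul_add_rpow (b : ℕ) {κ c : ℝ} (hκ : 0 < κ) (hc : c ≤ 1) :
    IntegrableOn (fun x : ℝ => x ^ b * Real.exp (-x) * (x + κ) ^ c) (Ioi 0) := by
  have h1 := integrableOn_pow_mul_exp_neg_mul b one_pos
  have h2 := integrableOn_pow_mul_exp_neg_mul (b + 1) one_pos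
  refine Integrable.mono' ((h1.const_mul (κ ^ c)).add (h2.const_mul (κ ^ c / κ))) ?_ ?_
  · exact Measurable.aestronglyMeasurable (by fun_prop)
  · filter_upwards [ae_restrict_mem measurableSet_Ioi] with x hx
    have hx' : (0 : ℝ) < x := hx
    -- As c ≤ 1, growth is at most linear, and two Gamma integrals dominate.
    have h3 : (x + κ) ^ c ≤ κ ^ c * (1 + x / κ) := by
      rw [show x + κ = κ * (1 + x / κ) by field_simp; ring, Real.mul_rpow hκ.le (by positivity)]
      gcongr
      have h4 : 1 ≤ 1 + x / κ := by
        have : 0 < x / κ := by positivity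
        linarith
      calc _ ≤ (1 + x / κ) ^ (1 : ℝ) := Real.rpow_le_rpow_of_exponent_le h4 hc
        _ = _ := Real.rpow_one _
    rw [Real.norm_eq_abs, abs_of_pos (by positivity)]
    calc _ ≤ x ^ b * Real.exp (-x) * (κ ^ c * (1 + x / κ)) := by gcongr
      _ = _ := by
        simp only [one_mul, Pi.add_apply]
        ring

theorem integrableOn_shiftedGamma (b : ℕ) {κ : ℝ} (hκ : 0 < κ) {t : ℂ} (ht : t.re ≤ 1) :
    IntegrableOn (fun x : ℝ => ((x ^ b * Real.exp (-x) : ℝ) : ℂ) * ((x + κ : ℝ) : ℂ) ^ t)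
      (Ioi 0) := by
  refine (integrableOn_pow_mul_exp_mul_add_rpow b hκ ht).mono' ?_ ?_
  · exact Measurable.aestronglyMeasurable (by fun_prop)
  · filter_upwards [ae_restrict_mem measurableSet_Ioi] with x hx
    have hx' : (0 : ℝ) < x := hx
    rw [norm_mul, Complex.norm_cpow_eq_rpow_re_of_pos (by positivity), Complex.norm_real,
      Real.norm_eq_abs, abs_of_pos (by positivity)]

/-- Integration by parts; κ^t is the boundary term at 0. For m = 1 it matches the residue at s = -t.
-/
theorem shiftedGamma_zero_eq {κ : ℝ} (hκ : 0 < κ) {t : ℂ} (ht : t.re ≤ 1) (ht0 : t ≠ 0) :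
    shiftedGamma 0 κ t = (κ : ℂ) ^ t + t * shiftedGamma 0 κ (t - 1) := by
  have hi := integrableOn_shiftedGamma 0 hκ ht
  have hi' := integrableOn_shiftedGamma 0 hκ (t := t - 1) (by simp; linarith)
  have hder : ∀ x : ℝ, 0 ≤ x → HasDerivAt (fun x : ℝ => ((x + κ : ℝ) : ℂ) ^ t)
      (t * ((x + κ : ℝ) : ℂ) ^ (t - 1)) x := by
    intro x hx
    have h1 := hasDerivAt_ofReal_cpow_const (x := x + κ) (by positivity) ht0
    simpa using h1.comp_add_const x κ
  have hparts := integral_Ioi_mul_deriv_eq_deriv_mul (a := (0 : ℝ)) (A := ℂ) (a' := -(κ : ℂ) ^ t)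
    (b' := 0) (u := fun x : ℝ => ((x + κ : ℝ) : ℂ) ^ t) (v := fun x : ℝ => -((Real.exp (-x) : ℝ) : ℂ))
    (u' := fun x : ℝ => t * ((x + κ : ℝ) : ℂ) ^ (t - 1)) (v' := fun x : ℝ => ((Real.exp (-x) : ℝ) : ℂ))
    (fun x hx => hder x (le_of_lt hx)) ?_ ?_ ?_ ?_ ?_
  · have h1 : shiftedGamma 0 κ t =
        ∫ x in Ioi (0 : ℝ), ((x + κ : ℝ) : ℂ) ^ t * ((Real.exp (-x) : ℝ) : ℂ) := by
      simp only [shiftedGamma, pow_zero, one_mul]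
      congr 1
      ext x
      ring
    have h2 : ∫ x in Ioi (0 : ℝ), t * ((x + κ : ℝ) : ℂ) ^ (t - 1) * -((Real.exp (-x) : ℝ) : ℂ) =
        -(t * shiftedGamma 0 κ (t - 1)) := by
      rw [shiftedGamma, ← integral_const_mul, ← integral_neg]
      congr 1
      ext x
      simp
      ring
    rw [h1, hparts, h2]
    ring
  · intro x _
    have h1 : HasDerivAt (fun x : ℝ => -Real.exp (-x)) (Real.exp (-x)) x := by
      have := ((hasDerivAt_neg x).exp).fun_neg
      simpa using this
    simpa using h1.ofReal_comp
  · refine hi.congr (Eventually.of_forall fun x => ?_)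
    simp
    ring
  · refine (hi'.const_mul (-t)).congr (Eventually.of_forall fun x => ?_)
    simp
    ring
  · have h1 : ContinuousAt (fun x : ℝ => ((x + κ : ℝ) : ℂ) ^ t * -((Real.exp (-x) : ℝ) : ℂ)) 0 :=
      (hder 0 le_rfl).continuousAt.mul (by fun_prop)
    have h2 := h1.tendsto
    simp only [zero_add, neg_zero, Real.exp_zero, Complex.ofReal_one, mul_neg, mul_one] at h2
    exact (h2.mono_left nhdsWithin_le_nhds).congr fun x => by simp
  · have h0 : Tendsto (fun x : ℝ => (x + κ) ^ t.re * Real.exp (-(x + κ)) * Real.exp κ) atTop (𝓝 0) := by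
      have h1 := (tendsto_rpow_mul_exp_neg_mul_atTop_nhds_zero t.re 1 one_pos).comp
        (tendsto_atTop_add_const_right atTop κ tendsto_id)
      have h2 := h1.mul_const (Real.exp κ)
      simpa using h2
    refine squeeze_zero_norm' ?_ h0
    filter_upwards [eventually_gt_atTop 0] with x hx
    rw [Pi.mul_apply, norm_mul, Complex.norm_cpow_eq_rpow_re_of_pos (by positivity), norm_neg,
      Complex.norm_real, Real.norm_eq_abs, Real.abs_exp, mul_assoc, ← Real.exp_add]
    refine le_of_eq ?_
    congr 2
    ring

theorem integrable_Gamma_mul_Gamma_neg_line (a : ℕ) {δ : ℝ}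
    (h₁ : ∀ n : ℕ, (a : ℝ) + δ ≠ -n) (h₂ : ∀ n : ℕ, δ ≠ n) :
    Integrable fun v : ℝ => Complex.Gamma (a + ((δ : ℂ) + v * Complex.I)) *
      Complex.Gamma (-((δ : ℂ) + v * Complex.I)) := by
  obtain ⟨C, hC0, hC⟩ := exists_norm_Gamma_mul_Gamma_neg_le_exp a δ δ
  refine integrable_of_norm_le_exp_neg_abs (C := C) (T := 1) ?_ fun v hv => ?_
  · refine continuous_iff_continuousAt.2 fun v => ContinuousAt.mul ?_ ?_
    · refine ContinuousAt.comp (f := fun v : ℝ => (a : ℂ) + ((δ : ℂ) + v * Complex.I))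
        (Complex.continuousAt_Gamma _ fun n hn => h₁ n ?_) (by fun_prop)
      simpa using congrArg Complex.re hn
    · refine ContinuousAt.comp (f := fun v : ℝ => -((δ : ℂ) + v * Complex.I))
        (Complex.continuousAt_Gamma _ fun n hn => h₂ n ?_) (by fun_prop)
      have := congrArg Complex.re hn
      simp at this
      linarith
  · simpa using hC ((δ : ℂ) + v * Complex.I) (by simp) (by simp) (by simpa using hv)

theorem integrableOn_rpow_mul_inv_mul_exp (b : ℕ) {κ p : ℝ} (hκ : 0 < κ) (hp : 0 < p) :
    IntegrableOn (fun u : ℝ => u ^ (p - 1) * ((1 + u) ^ (b + 1))⁻¹ * Real.exp (-(κ * u)))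
      (Ioi 0) := by
  have h := integrableOn_cpow_mul_exp_neg_mul (s := (p : ℂ)) (by simpa using hp) hκ
  refine h.norm.mono' ?_ ?_
  · exact Measurable.aestronglyMeasurable (by fun_prop)
  · filter_upwards [ae_restrict_mem measurableSet_Ioi] with u hu
    have hu' : (0 : ℝ) < u := hu
    rw [ofReal_mul_cpow_exp_norm hu', Real.norm_eq_abs, abs_of_pos (by positivity)]
    have h1 : ((1 + u) ^ (b + 1))⁻¹ ≤ 1 := inv_le_one_of_one_le₀ (one_le_pow₀ (by linarith))
    simp only [Complex.sub_re, Complex.ofReal_re, Complex.one_re]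
    calc _ ≤ u ^ (p - 1) * 1 * Real.exp (-(κ * u)) := by gcongr
      _ = _ := by ring

/-- Parseval with q(u) = b!(1+u)^{-(b+1)}. The resulting u-integral is one of the two evaluations in
`Gamma_mul_integral_add_cpow` at -t. -/
theorem integral_gammaTriple_line_of_neg (b : ℕ) {κ : ℝ} (hκ : 0 < κ) {t : ℂ} {σ : ℝ} (hσ : 0 < σ)
    (h₁ : σ + t.re < 0) (h₂ : -1 < σ + t.re) :
    ∫ v : ℝ, gammaTriple (b + 1) κ t (σ + v * Complex.I) =
      2 * Real.pi * (Complex.Gamma (-t) * shiftedGamma b κ t) := by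
  have hre : ∀ w : ℂ, w.re = σ + t.re → 0 < (-w).re ∧ (-w).re < (b : ℝ) + 1 := by
    intro w hw
    rw [Complex.neg_re, hw]
    have : (0 : ℝ) ≤ b := Nat.cast_nonneg b
    constructor <;> linarith
  have hfac : (b.factorial : ℂ) ≠ 0 := Nat.cast_ne_zero.2 b.factorial_ne_zero
  have h := integral_mellin_mul_Gamma (σ := σ) (t := t) (x := κ) hσ
    (q := fun u : ℝ => (b.factorial : ℂ) * ((((1 + u) ^ (b + 1))⁻¹ : ℝ) : ℂ))
    (Q := fun w => Complex.Gamma ((b + 1 : ℕ) + w) * Complex.Gamma (-w)) ?_ ?_ ?_ ?_ hκ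
  · have h3 : ∫ v : ℝ, gammaTriple (b + 1) κ t (σ + v * Complex.I) = ∫ v : ℝ,
        Complex.Gamma ((b + 1 : ℕ) + ((σ : ℂ) + v * Complex.I + t)) *
          Complex.Gamma (-((σ : ℂ) + v * Complex.I + t)) * Complex.Gamma (σ + v * Complex.I) *
        (κ : ℂ) ^ (-((σ : ℂ) + v * Complex.I)) := by
      rfl
    have hs : 0 < (-t).re := by
      rw [Complex.neg_re]
      linarith
    have h4 := Gamma_mul_integral_add_cpow b hκ.le hs (integrableOn_rpow_mul_inv_mul_exp b hκ hs)
    rw [neg_neg] at h4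
    rw [h3, h, shiftedGamma, h4]
    congr 1
    rw [← integral_const_mul]
    refine setIntegral_congr_fun measurableSet_Ioi fun u _ => ?_
    push_cast
    ring
  · intro w hw
    obtain ⟨h3, h4⟩ := hre w hw
    have := mellin_const_smul (fun u : ℝ => ((((1 + u) ^ (b + 1))⁻¹ : ℝ) : ℂ)) (-w)
      (b.factorial : ℂ)
    simp only [smul_eq_mul] at this
    rw [this, mellin_inv_one_add_pow b h3 h4]
    push_cast
    rw [sub_neg_eq_add]
    field_simp
  · obtain ⟨h3, h4⟩ := hre ((σ + t.re : ℝ) : ℂ) (by simp)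
    have := (mellinConvergent_inv_one_add_pow b h3 h4).const_smul (b.factorial : ℂ)
    simpa using this
  · refine integrable_Gamma_mul_Gamma_neg_line (b + 1) (fun n hn => ?_) fun n hn => ?_
    · push_cast at hn
      have : (0 : ℝ) ≤ b := Nat.cast_nonneg b
      have : (0 : ℝ) ≤ n := Nat.cast_nonneg n
      linarith
    · have : (0 : ℝ) ≤ n := Nat.cast_nonneg n
      linarith
  · intro u hu
    refine continuousAt_const.mul (Complex.continuous_ofReal.continuousAt.comp
      (ContinuousAt.inv₀ (by fun_prop) ?_))
    positivity

/-- With w = s+t, the line is now beyond the pole of Γ(-w) at w = 0. There Γ(1+w)Γ(-w) is the Mellin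
transform at -w of -u/(1+u) = 1/(1+u) - 1 instead of 1/(1+u). -/
theorem integral_gammaTriple_line_of_pos {κ : ℝ} (hκ : 0 < κ) {t : ℂ} {σ : ℝ} (hσ : 0 < σ)
    (h₁ : 0 < σ + t.re) (h₂ : σ + t.re < 1) :
    ∫ v : ℝ, gammaTriple 1 κ t (σ + v * Complex.I) =
      -(2 * Real.pi * (Complex.Gamma (1 - t) * shiftedGamma 0 κ (t - 1))) := by
  have hre : ∀ w : ℂ, w.re = σ + t.re → 0 < (-w + 1).re ∧ (-w + 1).re < ((0 : ℕ) : ℝ) + 1 := by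
    intro w hw
    rw [Complex.add_re, Complex.neg_re, hw, Complex.one_re, Nat.cast_zero]
    constructor <;> linarith
  have h := integral_mellin_mul_Gamma (σ := σ) (t := t) (x := κ) hσ
    (q := fun u : ℝ => (u : ℂ) ^ (1 : ℂ) • (-1 : ℂ) • ((((1 + u) ^ (0 + 1))⁻¹ : ℝ) : ℂ))
    (Q := fun w => Complex.Gamma ((1 : ℕ) + w) * Complex.Gamma (-w)) ?_ ?_ ?_ ?_ hκ
  · have h3 : ∫ v : ℝ, gammaTriple 1 κ t (σ + v * Complex.I) = ∫ v : ℝ,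
        Complex.Gamma ((1 : ℕ) + ((σ : ℂ) + v * Complex.I + t)) *
          Complex.Gamma (-((σ : ℂ) + v * Complex.I + t)) * Complex.Gamma (σ + v * Complex.I) *
        (κ : ℂ) ^ (-((σ : ℂ) + v * Complex.I)) := by
      rfl
    have hs : 0 < (1 - t).re := by
      rw [Complex.sub_re, Complex.one_re]
      linarith
    have h4 := Gamma_mul_integral_add_cpow 0 hκ.le hs (integrableOn_rpow_mul_inv_mul_exp 0 hκ hs)
    rw [neg_sub, Nat.factorial_zero, Nat.cast_one, one_mul] at h4
    rw [h3, h, shiftedGamma, h4, ← mul_neg, ← integral_neg]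
    congr 1
    refine setIntegral_congr_fun measurableSet_Ioi fun u hu => ?_
    have hu0 : (u : ℂ) ≠ 0 := Complex.ofReal_ne_zero.2 (ne_of_gt hu)
    simp only [smul_eq_mul, Complex.cpow_one]
    rw [show 1 - t - 1 = (-t - 1) + 1 by ring, Complex.cpow_add _ _ hu0, Complex.cpow_one]
    push_cast
    ring
  · intro w hw
    obtain ⟨h3, h4⟩ := hre w hw
    have hw0 : w ≠ 0 := by
      rintro rfl
      simp at hw
      linarith
    rw [mellin_cpow_smul, mellin_const_smul, mellin_inv_one_add_pow 0 h3 h4]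
    have h5 := Complex.Gamma_add_one (-w) (neg_ne_zero.2 hw0)
    have h6 := Complex.Gamma_add_one w hw0
    rw [h5]
    simp only [CharP.cast_eq_zero, zero_add, Nat.factorial_zero, Nat.cast_one, div_one, smul_eq_mul]
    rw [show (1 : ℂ) - (-w + 1) = w by ring, add_comm (1 : ℂ) w, h6]
    ring
  · obtain ⟨h3, h4⟩ := hre ((σ + t.re : ℝ) : ℂ) (by simp)
    have h5 := (mellinConvergent_inv_one_add_pow 0 h3 h4).const_smul (-1 : ℂ)
    have h6 := (MellinConvergent.cpow_smul (a := 1)).2 h5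
    rwa [← Complex.ofReal_neg] at h6
  · refine integrable_Gamma_mul_Gamma_neg_line 1 (fun n hn => ?_) fun n hn => ?_
    · push_cast at hn
      have : (0 : ℝ) ≤ n := Nat.cast_nonneg n
      linarith
    · rcases n with _ | n
      · simp at hn
        linarith
      · push_cast at hn
        have : (0 : ℝ) ≤ n := Nat.cast_nonneg n
        linarith
  · intro u hu
    simp only [Complex.cpow_one, smul_eq_mul]
    refine Complex.continuous_ofReal.continuousAt.mul (continuousAt_const.mul
      (Complex.continuous_ofReal.continuousAt.comp (ContinuousAt.inv₀ (by fun_prop) ?_)))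
    positivity

/-! ### Two explicit separating contours -/

/-- The contour without indentations for `Re t < 0`. -/
def straightContour (c : ℝ) : Meijer.Contour := ⟨-c - min 1 (-c) / 2, ∅, 1⟩

/-- The abscissa is at least half of -Re t > 0, and at most 1/2 to the left of the first right pole
-t. Thus σ > 0 and -1 < σ + Re t < 0, as the evaluation on the line requires. -/
theorem straightContour_separates {a : ℕ} (ha : 1 ≤ a) {t : ℂ} (ht : t.re < 0) :
    (straightContour t.re).Separates (tripleLeft a t) (tripleRight t) := by
  have h1 : 0 < min 1 (-t.re) := lt_min one_pos (by linarith)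
  have h2 : min 1 (-t.re) ≤ 1 := min_le_left _ _
  have h3 : min 1 (-t.re) ≤ -t.re := min_le_right _ _
  have ha' : (1 : ℝ) ≤ a := by exact_mod_cast ha
  have hl : ∀ z ∈ tripleLeft a t, z.re < -t.re - min 1 (-t.re) / 2 := by
    rintro z (⟨n, hn⟩ | ⟨n, hn⟩)
    · have h4 := congrArg Complex.re hn
      simp at h4
      have : (0 : ℝ) ≤ n := Nat.cast_nonneg n
      linarith
    · have h4 := congrArg Complex.re hn
      simp at h4
      have : (0 : ℝ) ≤ n := Nat.cast_nonneg n
      linarith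
  have hr : ∀ z ∈ tripleRight t, -t.re - min 1 (-t.re) / 2 < z.re := by
    rintro z ⟨n, hn⟩
    have h4 := congrArg Complex.re hn
    simp at h4
    have : (0 : ℝ) ≤ n := Nat.cast_nonneg n
    linarith
  constructor
  · exact one_pos
  · rintro z (hz | hz)
    · exact (hl z hz).ne
    · exact (hr z hz).ne'
  · intro z hz
    simpa [straightContour] using (hl z hz).le
  · intro z hz
    simpa [straightContour] using (hr z hz).le
  all_goals simp [straightContour]

/-- The contour with one indentation for `0 < Re t < 1`. -/
def indentedContour (t : ℂ) : Meijer.Contour := ⟨(1 - t.re) / 2, {-t}, min t.re (1 - t.re) / 2⟩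

/-- The line is midway between the left pole 0 and the real part of the right pole 1 - t. Only the
right pole -t is on the wrong side, and every other pole is at horizontal distance at least min(Re
t, 1 - Re t) from it, twice the radius. -/
theorem indentedContour_separates {t : ℂ} (ht : 0 < t.re) (ht' : t.re < 1) :
    (indentedContour t).Separates (tripleLeft 1 t) (tripleRight t) := by
  have h1 : 0 < min t.re (1 - t.re) := lt_min ht (by linarith)
  have h2 : min t.re (1 - t.re) ≤ t.re := min_le_left _ _
  have h3 : min t.re (1 - t.re) ≤ 1 - t.re := min_le_right _ _
  have hl' : ∀ z ∈ tripleLeft 1 t, z.re ≤ -1 - t.re ∨ z.re ≤ -1 ∨ z.re = 0 := by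
    rintro z (⟨n, hn⟩ | ⟨n, hn⟩)
    · have h4 := congrArg Complex.re hn
      simp at h4
      have : (0 : ℝ) ≤ n := Nat.cast_nonneg n
      left
      linarith
    · have h4 := congrArg Complex.re hn
      simp at h4
      rcases n with _ | n
      · right; right
        simpa using h4
      · push_cast at h4
        have : (0 : ℝ) ≤ n := Nat.cast_nonneg n
        right; left
        linarith
  have hr' : ∀ z ∈ tripleRight t, z = -t ∨ 1 - t.re ≤ z.re := by
    rintro z ⟨n, hn⟩
    have h4 := congrArg Complex.re hn
    simp at h4
    rcases n with _ | n
    · left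
      linear_combination hn
    · push_cast at h4
      have : (0 : ℝ) ≤ n := Nat.cast_nonneg n
      right
      linarith
  have hl : ∀ z ∈ tripleLeft 1 t, z.re < (1 - t.re) / 2 ∧ z ≠ -t := by
    intro z hz
    refine ⟨?_, ?_⟩
    · rcases hl' z hz with h | h | h <;> linarith
    · rintro rfl
      rcases hl' _ hz with h | h | h <;> simp at h <;> linarith
  constructor
  · simpa [indentedContour] using h1
  · rintro z (hz | hz)
    · exact (hl z hz).1.ne
    · rcases hr' z hz with rfl | h
      · simp only [indentedContour, Complex.neg_re]
        linarith
      · simp only [indentedContour]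
        linarith
  · intro z hz
    simpa [indentedContour, (hl z hz).2] using (hl z hz).1.le
  · intro z hz
    simp only [indentedContour, Finset.mem_singleton]
    rcases hr' z hz with rfl | h
    · simp only [Complex.neg_re, true_iff]
      linarith
    · refine ⟨?_, fun h' => by linarith⟩
      rintro rfl
      simp at h
      linarith
  · intro z hz
    simp only [indentedContour, Finset.mem_singleton] at hz
    right
    exact ⟨0, by simp [hz]⟩
  · intro z hz
    simp only [indentedContour, Finset.mem_singleton] at hz ⊢
    subst hz
    rw [abs_sub_comm, Complex.neg_re, abs_of_pos (by linarith)]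
    linarith
  · intro z hz w hw hne
    simp only [indentedContour, Finset.mem_singleton] at hz ⊢
    subst hz
    have key : t.re ≤ |w.re + t.re| ∨ 1 - t.re ≤ |w.re + t.re| := by
      rcases hw with hw | hw
      · rcases hl' w hw with h | h | h
        · right
          rw [abs_of_neg (by linarith)]
          linarith
        · right
          rw [abs_of_neg (by linarith)]
          linarith
        · left
          rw [h, zero_add]
          exact le_abs_self _
      · rcases hr' w hw with h | h
        · exact absurd h hne
        · right
          rw [abs_of_pos (by linarith)]
          linarith
    have hd : |w.re + t.re| ≤ dist w (-t) := by
      rw [Complex.dist_eq, sub_neg_eq_add, ← Complex.add_re]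
      exact Complex.abs_re_le_norm _
    rcases key with h | h <;> linarith

/-- Near s = -t, Γ(-(s+t)) = -Γ(1-(s+t))/(s+t), so the residue is -Γ(-t)κ^t. -/
theorem circleIntegral_gammaTriple_one {κ : ℝ} (hκ : 0 < κ) {t : ℂ} (ht : ∀ n : ℤ, t ≠ n) {r : ℝ}
    (hr : 0 < r) (hiso : ∀ w ∈ tripleLeft 1 t ∪ tripleRight t, w ≠ -t → r < dist w (-t)) :
    circleIntegral (gammaTriple 1 κ t) (-t) r =
      -(2 * Real.pi * Complex.I * (Complex.Gamma (-t) * (κ : ℂ) ^ t)) := by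
  have hadd : AnalyticAt ℂ (fun s : ℂ => s + t) (-t) := analyticAt_id.add analyticAt_const
  have hone : ∀ n : ℕ, (1 : ℂ) ≠ -n := by
    intro n hn
    have := congrArg Complex.re hn
    simp at this
    have h2 : (0 : ℝ) ≤ n := Nat.cast_nonneg n
    linarith
  have hφ : AnalyticAt ℂ (fun s : ℂ => -(Complex.Gamma (1 + (s + t)) * Complex.Gamma (1 - (s + t)) *
      Complex.Gamma s * (κ : ℂ) ^ (-s))) (-t) := by
    refine (AnalyticAt.mul (AnalyticAt.mul (AnalyticAt.mul ?_ ?_) ?_)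
      (analyticAt_ofReal_cpow_neg hκ _)).neg
    · exact (Complex.analyticAt_Gamma hone).comp_of_eq (analyticAt_const.add hadd) (by simp)
    · exact (Complex.analyticAt_Gamma hone).comp_of_eq (analyticAt_const.sub hadd) (by simp)
    · refine Complex.analyticAt_Gamma fun n hn => ht n ?_
      push_cast
      linear_combination -hn
  have hpart := HasSimplePart.of_analytic_mul (f := gammaTriple 1 κ t) hφ (by
    filter_upwards [self_mem_nhdsWithin] with s hs
    have hs0 : s + t ≠ 0 := fun h => hs (by
      rw [mem_singleton_iff]
      linear_combination h)
    have h1 := Complex.Gamma_add_one (-(s + t)) (neg_ne_zero.2 hs0)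
    rw [show -(s + t) + 1 = 1 - (s + t) by ring] at h1
    rw [h1, gammaTriple, sub_neg_eq_add]
    push_cast
    field_simp)
  rw [hpart.circleIntegral_eq hr]
  · simp
  · intro w hw hne
    exact analyticAt_gammaTriple hκ fun hP => absurd (hiso w hP hne) (not_lt.2 hw)

/-- The integral of `Γ(a + s + t) Γ(-s - t) Γ(s) κ^{-s}` over a separating contour. -/
theorem integral_gammaTriple (b : ℕ) {κ : ℝ} (hκ : 0 < κ) {t : ℂ}
    (ht : (t.re < 0 ∧ ∀ n : ℤ, t ≠ n) ∨ (b = 0 ∧ 0 < t.re ∧ t.re < 1)) {L : Meijer.Contour}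
    (hL : L.Separates (tripleLeft (b + 1) t) (tripleRight t)) :
    L.integral (gammaTriple (b + 1) κ t) =
      2 * Real.pi * Complex.I * (Complex.Gamma (-t) * shiftedGamma b κ t) := by
  rcases ht with ⟨h1, h2⟩ | ⟨rfl, h1, h2⟩
  · rw [integral_gammaTriple_eq (by omega) hκ h2 hL (straightContour_separates (by omega) h1)]
    have h3 : 0 < min 1 (-t.re) := lt_min one_pos (by linarith)
    have h4 : min 1 (-t.re) ≤ 1 := min_le_left _ _
    have h5 : min 1 (-t.re) ≤ -t.re := min_le_right _ _
    have := integral_gammaTriple_line_of_neg b hκ (t := t) (σ := -t.re - min 1 (-t.re) / 2)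
      (by linarith) (by linarith) (by linarith)
    simp only [Meijer.Contour.integral, straightContour, Meijer.Contour.line, Finset.sum_empty,
      add_zero]
    rw [integral_mul_const, this]
    ring
  · have hne : ∀ n : ℤ, t ≠ n := by
      rintro n rfl
      simp only [Complex.intCast_re] at h1 h2
      have h3 : (0 : ℤ) < n := by exact_mod_cast h1
      have h4 : n < (1 : ℤ) := by exact_mod_cast h2
      omega
    have hsep := indentedContour_separates h1 h2
    rw [zero_add] at hL ⊢
    rw [integral_gammaTriple_eq le_rfl hκ hne hL hsep]
    have hline := integral_gammaTriple_line_of_pos hκ (t := t) (σ := (1 - t.re) / 2)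
      (by linarith) (by linarith) (by linarith)
    have hcirc := circleIntegral_gammaTriple_one hκ hne hsep.radius_pos
      (hsep.circle_isolates (-t) (by simp [indentedContour]))
    have ht0 : t ≠ 0 := by simpa using hne 0
    -- Write S for `shiftedGamma 0 κ`. Up to 2πi, the line gives -Γ(1-t)S(t-1) = tΓ(-t)S(t-1) and
    -- the clockwise circle gives Γ(-t)κ^t. The recursion adds these to Γ(-t)S(t).
    have hrec := shiftedGamma_zero_eq hκ h2.le ht0
    have hG := Complex.Gamma_add_one (-t) (neg_ne_zero.2 ht0)
    rw [show -t + 1 = 1 - t by ring] at hG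
    simp only [Meijer.Contour.integral, Meijer.Contour.line]
    have hc : (indentedContour t).centres = {-t} := rfl
    have ha : (indentedContour t).abscissa = (1 - t.re) / 2 := rfl
    rw [hc, Finset.sum_singleton, hcirc, ha, integral_mul_const, hline, if_neg (by
      rw [Complex.neg_re]
      linarith), hrec, hG]
    ring

/-! ### The outer integral -/

/-- The function `Γ(1 - p) Γ(p) / p = π / (p sin π p)`, the Mellin transform of `log (1 + u)`. -/
def logMellin (p : ℂ) : ℂ := Complex.Gamma (1 - p) * Complex.Gamma p / p

theorem integrable_logMellin_line {δ : ℝ} (h₀ : 0 < δ) (h₁ : δ < 1) :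
    Integrable fun v : ℝ => logMellin (δ + v * Complex.I) := by
  have h := integrable_Gamma_mul_Gamma_neg_line 1 (δ := -δ) (fun n hn => by
      push_cast at hn
      have : (0 : ℝ) ≤ n := Nat.cast_nonneg n
      linarith) (fun n hn => by
      have : (0 : ℝ) ≤ n := Nat.cast_nonneg n
      linarith)
  have hne : ∀ v : ℝ, (δ : ℂ) + v * Complex.I ≠ 0 := by
    intro v hv
    have := congrArg Complex.re hv
    simp at this
    exact h₀.ne' this
  have h2 := h.comp_neg
  refine (h2.bdd_mul (f := fun v : ℝ => ((δ : ℂ) + v * Complex.I)⁻¹) (c := δ⁻¹) ?_ ?_).congr ?_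
  · exact (Continuous.inv₀ (by fun_prop) hne).aestronglyMeasurable
  · refine Eventually.of_forall fun v => ?_
    rw [norm_inv]
    gcongr
    have := Complex.abs_re_le_norm ((δ : ℂ) + v * Complex.I)
    simp at this
    exact (le_abs_self δ).trans this
  · refine Eventually.of_forall fun v => ?_
    simp only [logMellin]
    rw [show ((1 : ℕ) : ℂ) + (((-δ : ℝ) : ℂ) + ((-v : ℝ) : ℂ) * Complex.I) =
      1 - ((δ : ℂ) + v * Complex.I) by push_cast; ring,
      show -(((-δ : ℝ) : ℂ) + ((-v : ℝ) : ℂ) * Complex.I) = (δ : ℂ) + v * Complex.I by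
        push_cast; ring]
    ring

theorem integral_cpow_mul_logMellin {δ : ℝ} (h₀ : 0 < δ) (h₁ : δ < 1) {u : ℝ} (hu : 0 < u) :
    ∫ v : ℝ, (u : ℂ) ^ ((δ : ℂ) + v * Complex.I) * logMellin (δ + v * Complex.I) =
      2 * Real.pi * ((Real.log (1 + u) : ℝ) : ℂ) := by
  refine integral_cpow_mul_mellin_neg (q := fun u : ℝ => ((Real.log (1 + u) : ℝ) : ℂ))
    (fun w hw => ?_) (mellinConvergent_log_one_add ?_ ?_) (integrable_logMellin_line h₀ h₁) hu ?_
  · rw [mellin_log_one_add (by rw [Complex.neg_re, hw]; linarith)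
      (by rw [Complex.neg_re, hw]; linarith), logMellin, neg_neg, ← sub_eq_add_neg]
  · rw [Complex.ofReal_re]
    linarith
  · rw [Complex.ofReal_re]
    linarith
  · refine Complex.continuous_ofReal.continuousAt.comp (ContinuousAt.log (by fun_prop) ?_)
    positivity

/-- The product of two half-lines. -/
abbrev quadrantMeasure : Measure (ℝ × ℝ) :=
  (volume.restrict (Ioi (0 : ℝ))).prod (volume.restrict (Ioi (0 : ℝ)))

theorem ae_quadrant : ∀ᵐ z ∂quadrantMeasure, 0 < z.1 ∧ 0 < z.2 := by
  have h1 : ∀ᵐ z ∂quadrantMeasure, z.1 ∈ Ioi (0 : ℝ) :=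
    Measure.quasiMeasurePreserving_fst.ae (ae_restrict_mem measurableSet_Ioi)
  have h2 : ∀ᵐ z ∂quadrantMeasure, z.2 ∈ Ioi (0 : ℝ) :=
    Measure.quasiMeasurePreserving_snd.ae (ae_restrict_mem measurableSet_Ioi)
  filter_upwards [h1, h2] with z hz1 hz2 using ⟨hz1, hz2⟩

/-- The weight `g^i e^{-g} x^b e^{-x} / (x + κ)^(b + i)`. -/
def gammaWeight (b i : ℕ) (κ g x : ℝ) : ℝ :=
  g ^ i * Real.exp (-g) * (x ^ b * Real.exp (-x)) * ((x + κ) ^ (b + i))⁻¹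

/-- The integral `∫∫ g^i e^{-g} x^b e^{-x} (x + κ)^{-(b+i)} log (1 + g (x + κ) / y) dg dx`. -/
def logMoment (b i : ℕ) (κ y : ℝ) : ℝ :=
  ∫ z, gammaWeight b i κ z.1 z.2 * Real.log (1 + z.1 * (z.2 + κ) / y) ∂quadrantMeasure

/-- The p-th power of g(x+κ)/y separates the variables: the g-factor integrates to Γ(i+1+p), the
x-factor to `shiftedGamma b κ (p - (b + i))`. -/
theorem gammaWeight_mul_cpow (b i : ℕ) {κ y g x : ℝ} (hκ : 0 < κ) (hy : 0 < y) (hg : 0 < g)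
    (hx : 0 < x) (p : ℂ) :
    (gammaWeight b i κ g x : ℂ) * ((g * (x + κ) / y : ℝ) : ℂ) ^ p =
      (y : ℂ) ^ (-p) * ((((Real.exp (-g) : ℝ) : ℂ) * (g : ℂ) ^ (i + 1 + p - 1)) *
        (((x ^ b * Real.exp (-x) : ℝ) : ℂ) * ((x + κ : ℝ) : ℂ) ^ (p - (b + i : ℕ)))) := by
  have hxκ : 0 < x + κ := by positivity
  have hxκ0 : ((x + κ : ℝ) : ℂ) ≠ 0 := Complex.ofReal_ne_zero.2 hxκ.ne'
  have hg0 : (g : ℂ) ≠ 0 := Complex.ofReal_ne_zero.2 hg.ne'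
  rw [div_eq_mul_inv, Complex.ofReal_mul, Complex.mul_cpow_ofReal_nonneg (by positivity)
    (by positivity), Complex.ofReal_mul, Complex.mul_cpow_ofReal_nonneg hg.le hxκ.le,
    Complex.ofReal_inv, Complex.inv_cpow _ _ (by
      rw [Complex.arg_ofReal_of_nonneg hy.le]
      exact Real.pi_pos.ne), Complex.cpow_neg, Complex.cpow_sub _ _ hxκ0, Complex.cpow_natCast,
    show (i : ℂ) + 1 + p - 1 = i + p by ring, Complex.cpow_add _ _ hg0, Complex.cpow_natCast,
    gammaWeight]
  push_cast
  field_simp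

theorem gammaWeight_mul_rpow_integrable (b i : ℕ) {κ y δ : ℝ} (hκ : 0 < κ) (hy : 0 < y)
    (h₀ : 0 < δ) (h₁ : δ < 1) :
    Integrable (fun z : ℝ × ℝ => (gammaWeight b i κ z.1 z.2 : ℂ) *
      ((z.1 * (z.2 + κ) / y : ℝ) : ℂ) ^ (δ : ℂ)) quadrantMeasure := by
  have hc : ((δ : ℂ) - (b + i : ℕ)).re ≤ 1 := by
    simp
    have h2 : (0 : ℝ) ≤ b := Nat.cast_nonneg b
    have h3 : (0 : ℝ) ≤ i := Nat.cast_nonneg i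
    linarith
  have h := ((Complex.GammaIntegral_convergent (s := (i : ℂ) + 1 + δ) (by simp; positivity)).mul_prod
    (integrableOn_shiftedGamma b hκ hc)).const_mul ((y : ℂ) ^ (-(δ : ℂ)))
  refine h.congr ?_
  filter_upwards [ae_quadrant] with z hz
  exact (gammaWeight_mul_cpow b i hκ hy hz.1 hz.2 δ).symm

theorem measurable_gammaWeight (b i : ℕ) (κ : ℝ) :
    Measurable fun z : ℝ × ℝ => gammaWeight b i κ z.1 z.2 := by
  simp only [gammaWeight]
  fun_prop

/-- Fubini on a triple integral. Over (g, x) first the variables separate; over v first, Mellin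
inversion yields log(1 + g(x+κ)/y). On the line the norm of the p-th power does not depend on v, so
the integrand is dominated by a product. -/
theorem integral_logMellin_mul_Gamma (b i : ℕ) {κ y δ : ℝ} (hκ : 0 < κ) (hy : 0 < y)
    (h₀ : 0 < δ) (h₁ : δ < 1) :
    (Integrable fun v : ℝ => logMellin (δ + v * Complex.I) * ((y : ℂ) ^ (-((δ : ℂ) + v * Complex.I)) *
      (Complex.Gamma (i + 1 + ((δ : ℂ) + v * Complex.I)) *
        shiftedGamma b κ ((δ : ℂ) + v * Complex.I - (b + i : ℕ))))) ∧
    ∫ v : ℝ, logMellin (δ + v * Complex.I) * ((y : ℂ) ^ (-((δ : ℂ) + v * Complex.I)) *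
      (Complex.Gamma (i + 1 + ((δ : ℂ) + v * Complex.I)) *
        shiftedGamma b κ ((δ : ℂ) + v * Complex.I - (b + i : ℕ)))) =
      2 * Real.pi * (logMoment b i κ y : ℂ) := by
  set F : ℝ → ℝ × ℝ → ℂ := fun v z => logMellin (δ + v * Complex.I) *
    ((gammaWeight b i κ z.1 z.2 : ℂ) *
      ((z.1 * (z.2 + κ) / y : ℝ) : ℂ) ^ ((δ : ℂ) + v * Complex.I)) with hF
  have hM := integrable_logMellin_line h₀ h₁
  have hint : Integrable (Function.uncurry F) (volume.prod quadrantMeasure) := by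
    refine (hM.norm.mul_prod (gammaWeight_mul_rpow_integrable b i hκ hy h₀ h₁).norm).mono' ?_ ?_
    · refine hM.aestronglyMeasurable.comp_fst.mul (Measurable.aestronglyMeasurable ?_)
      have : Measurable fun q : ℝ × (ℝ × ℝ) => gammaWeight b i κ q.2.1 q.2.2 :=
        (measurable_gammaWeight b i κ).comp measurable_snd
      refine (Complex.measurable_ofReal.comp this).mul ?_
      fun_prop
    · have : ∀ᵐ q : ℝ × (ℝ × ℝ) ∂(volume.prod quadrantMeasure), 0 < q.2.1 ∧ 0 < q.2.2 :=
        Measure.quasiMeasurePreserving_snd.ae ae_quadrant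
      filter_upwards [this] with q hq
      have h3 : 0 < q.2.1 * (q.2.2 + κ) / y := by
        have := hq.1
        have := hq.2
        positivity
      simp only [Function.uncurry_def, hF]
      rw [norm_mul, norm_mul, norm_mul, Complex.norm_cpow_eq_rpow_re_of_pos h3,
        Complex.norm_cpow_eq_rpow_re_of_pos h3]
      simp
  have hz : ∀ v : ℝ, ∫ z, F v z ∂quadrantMeasure = logMellin (δ + v * Complex.I) *
      ((y : ℂ) ^ (-((δ : ℂ) + v * Complex.I)) *
      (Complex.Gamma (i + 1 + ((δ : ℂ) + v * Complex.I)) *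
        shiftedGamma b κ ((δ : ℂ) + v * Complex.I - (b + i : ℕ)))) := by
    intro v
    have hcongr : ∀ᵐ z ∂quadrantMeasure, F v z = logMellin (δ + v * Complex.I) *
        ((y : ℂ) ^ (-((δ : ℂ) + v * Complex.I)) * ((((Real.exp (-z.1) : ℝ) : ℂ) *
          (z.1 : ℂ) ^ (i + 1 + ((δ : ℂ) + v * Complex.I) - 1)) *
        (((z.2 ^ b * Real.exp (-z.2) : ℝ) : ℂ) *
          ((z.2 + κ : ℝ) : ℂ) ^ (((δ : ℂ) + v * Complex.I) - (b + i : ℕ))))) := by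
      filter_upwards [ae_quadrant] with z hz
      simp only [hF]
      rw [gammaWeight_mul_cpow b i hκ hy hz.1 hz.2]
    rw [integral_congr_ae hcongr, integral_const_mul, integral_const_mul,
      integral_prod_mul (μ := volume.restrict (Ioi (0 : ℝ))) (ν := volume.restrict (Ioi (0 : ℝ)))
        (fun g : ℝ => ((Real.exp (-g) : ℝ) : ℂ) * (g : ℂ) ^ (i + 1 + ((δ : ℂ) + v * Complex.I) - 1))
        (fun x : ℝ => ((x ^ b * Real.exp (-x) : ℝ) : ℂ) *
          ((x + κ : ℝ) : ℂ) ^ (((δ : ℂ) + v * Complex.I) - (b + i : ℕ))),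
      Complex.Gamma_eq_integral (s := i + 1 + ((δ : ℂ) + v * Complex.I)) (by simp; positivity)]
    rfl
  have hv : ∀ᵐ z ∂quadrantMeasure, ∫ v : ℝ, F v z =
      2 * Real.pi * ((gammaWeight b i κ z.1 z.2 * Real.log (1 + z.1 * (z.2 + κ) / y) : ℝ) : ℂ) := by
    filter_upwards [ae_quadrant] with z hz
    have h3 : 0 < z.1 * (z.2 + κ) / y := by
      have := hz.1
      have := hz.2
      positivity
    have h4 : ∀ v : ℝ, F v z = (gammaWeight b i κ z.1 z.2 : ℂ) *
        (((z.1 * (z.2 + κ) / y : ℝ) : ℂ) ^ ((δ : ℂ) + v * Complex.I) *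
          logMellin (δ + v * Complex.I)) := by
      intro v
      simp only [hF]
      ring
    simp only [h4]
    rw [integral_const_mul, integral_cpow_mul_logMellin h₀ h₁ h3]
    push_cast
    ring
  have hi := hint.integral_prod_left
  simp only [Function.uncurry_apply_pair, hz] at hi
  refine ⟨hi, ?_⟩
  simp only [← hz]
  rw [integral_integral_swap hint, integral_congr_ae hv, integral_const_mul,
    integral_complex_ofReal, logMoment]

/-! ### The Meijer G-function of the capacity -/

theorem capacityBlock₁_eq (b i : ℕ) :
    capacityBlock₁ (b + i + 1) i = ⟨1, 1, [1], [((b + 1 : ℕ) : ℂ)]⟩ := by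
  rw [capacityBlock₁]
  congr 2
  push_cast
  ring

theorem capacityBlock₃_eq (b i : ℕ) :
    capacityBlock₃ (b + i + 1) i = ⟨3, 1, [((b + i : ℕ) : ℂ), ((b + i : ℕ) : ℂ) + 1],
      [((b + i : ℕ) : ℂ), ((b + i : ℕ) : ℂ), ((b + i : ℕ) : ℂ) + 1 + i, 1]⟩ := by
  have h : ((b + i + 1 : ℕ) : ℂ) - 1 = ((b + i : ℕ) : ℂ) := by
    push_cast
    ring
  rw [capacityBlock₃, h, Nat.cast_succ (b + i)]

theorem innerLeft_capacityBlock (b i : ℕ) (t : ℂ) :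
    Meijer.innerLeft (capacityBlock₁ (b + i + 1) i) capacityBlock₂ t = tripleLeft (b + 1) t := by
  ext s
  simp [Meijer.innerLeft, Meijer.Block.leftPoles, capacityBlock₁_eq, capacityBlock₂, tripleLeft]

theorem innerRight_capacityBlock (b i : ℕ) (t : ℂ) :
    Meijer.innerRight (capacityBlock₁ (b + i + 1) i) capacityBlock₂ t = tripleRight t := by
  ext s
  simp [Meijer.innerRight, Meijer.Block.rightPoles, capacityBlock₁, capacityBlock₂, tripleRight]

theorem innerIntegrand_capacityBlock (b i : ℕ) (κ : ℝ) (t : ℂ) :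
    Meijer.innerIntegrand (capacityBlock₁ (b + i + 1) i) capacityBlock₂ (κ : ℂ) t =
      gammaTriple (b + 1) κ t := by
  ext s
  simp [Meijer.innerIntegrand, Meijer.Block.kernel, capacityBlock₁_eq, capacityBlock₂, gammaTriple]

/-- With p = t+m-1, Γ(p)²/Γ(p+1) = Γ(p)/p. The factor 1/Γ(-t) is kept, to be cancelled by the
s-integral. -/
theorem kernel_capacityBlock₃ (b i : ℕ) {p : ℂ} (h₀ : 0 < p.re) :
    (capacityBlock₃ (b + i + 1) i).kernel (p - (b + i : ℕ)) =
      logMellin p * Complex.Gamma (i + 1 + p) / Complex.Gamma (-(p - (b + i : ℕ))) := by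
  have hp : p ≠ 0 := by
    rintro rfl
    simp at h₀
  have hΓ := Complex.Gamma_ne_zero_of_re_pos h₀
  generalize hn : ((b + i : ℕ) : ℂ) = n
  have h1 : n + (p - n) = p := by ring
  have h2 : n + 1 + i + (p - n) = i + 1 + p := by ring
  have h3 : n + 1 + (p - n) = p + 1 := by ring
  have h4 : 1 - n - (p - n) = 1 - p := by ring
  have h5 : 1 - 1 - (p - n) = -(p - n) := by ring
  simp only [Meijer.Block.kernel, capacityBlock₃_eq, hn, List.take_succ_cons, List.take_zero,
    List.drop_succ_cons, List.drop_zero, List.map_cons, List.map_nil, List.prod_cons, List.prod_nil,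
    mul_one, h1, h2, h3, h4, h5, Complex.Gamma_add_one p hp, logMellin]
  field_simp

/-! ### Admissible contours and the value of the G-function -/

/-- The extreme poles are 1-m on the left and 2-m on the right. They bound a strip of width one that
contains no integer. -/
theorem outer_separates_iff (b i : ℕ) (c : ℝ) :
    (Meijer.lineContour c).Separates (capacityBlock₃ (b + i + 1) i).leftPoles
      (capacityBlock₃ (b + i + 1) i).rightPoles ↔ -((b + i : ℕ) : ℝ) < c ∧ c < 1 - (b + i : ℕ) := by
  set n : ℕ := b + i with hn
  constructor
  · intro h
    have hl : (-(n : ℂ) - (0 : ℕ)) ∈ (capacityBlock₃ (b + i + 1) i).leftPoles := by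
      rw [capacityBlock₃_eq]
      exact ⟨n, by simp [hn], 0, rfl⟩
    have hr : (1 - (n : ℂ) + (0 : ℕ)) ∈ (capacityBlock₃ (b + i + 1) i).rightPoles := by
      rw [capacityBlock₃_eq]
      exact ⟨n, by simp [hn], 0, rfl⟩
    have h1 := h.left _ hl
    have h2 := h.right _ hr
    have h3 := h.off_line _ (Or.inl hl)
    have h4 := h.off_line _ (Or.inr hr)
    simp [Meijer.lineContour] at h1 h2 h3 h4
    exact ⟨lt_of_le_of_ne h1 h3, lt_of_le_of_ne h2 (Ne.symm h4)⟩
  · rintro ⟨h1, h2⟩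
    have hl : ∀ z ∈ (capacityBlock₃ (b + i + 1) i).leftPoles, z.re < c := by
      rw [capacityBlock₃_eq]
      rintro z ⟨β, hβ, N, rfl⟩
      have hN : (0 : ℝ) ≤ N := Nat.cast_nonneg N
      have hi : (0 : ℝ) ≤ i := Nat.cast_nonneg i
      simp only [List.take_succ_cons, List.take_zero, List.mem_cons, List.not_mem_nil,
        or_false] at hβ
      rcases hβ with rfl | rfl | rfl <;>
      · simp only [Complex.sub_re, Complex.neg_re, Complex.natCast_re, Complex.add_re,
          Complex.one_re]
        linarith
    have hr : ∀ z ∈ (capacityBlock₃ (b + i + 1) i).rightPoles, c < z.re := by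
      rw [capacityBlock₃_eq]
      rintro z ⟨β, hβ, N, rfl⟩
      have hN : (0 : ℝ) ≤ N := Nat.cast_nonneg N
      simp only [List.take_succ_cons, List.take_zero, List.mem_cons, List.not_mem_nil,
        or_false] at hβ
      subst hβ
      simp only [Complex.sub_re, Complex.natCast_re, Complex.add_re, Complex.one_re]
      linarith
    constructor
    · exact one_pos
    · rintro z (hz | hz)
      · exact (hl z hz).ne
      · exact (hr z hz).ne'
    · intro z hz
      simpa [Meijer.lineContour] using (hl z hz).le
    · intro z hz
      simpa [Meijer.lineContour] using (hr z hz).le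
    all_goals simp [Meijer.lineContour]

theorem exists_admissible (b i : ℕ) : ∃ (c : ℝ) (L : ℂ → Meijer.Contour),
    Meijer.Admissible (capacityBlock₁ (b + i + 1) i) capacityBlock₂
      (capacityBlock₃ (b + i + 1) i) c L := by
  -- The middle of the strip. Only b + i = 0, that is m = 1, puts it at positive real part and calls
  -- for the indentation.
  refine ⟨1 / 2 - (b + i : ℕ),
    fun t => if b + i = 0 then indentedContour t else straightContour t.re, ?_, ?_, ?_, ?_⟩
  · rw [outer_separates_iff]
    constructor <;> linarith
  · intro t ht
    rw [innerLeft_capacityBlock, innerRight_capacityBlock]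
    split_ifs with h
    · have hb : b = 0 := by omega
      subst hb
      rw [h, Nat.cast_zero, sub_zero] at ht
      exact indentedContour_separates (by rw [ht]; norm_num) (by rw [ht]; norm_num)
    · refine straightContour_separates (by omega) ?_
      have h1 : (1 : ℝ) ≤ (b + i : ℕ) := by exact_mod_cast Nat.one_le_iff_ne_zero.2 h
      rw [ht]
      linarith
  · rintro τ ⟨α, hα, N, rfl⟩ s ⟨β, hβ, N', rfl⟩
    -- Poles s+t = N and s = -N' collide at t = N + N', where the factor 1/Γ(-t) of Ψ₃, from its
    -- lower parameter 1, vanishes. For m = 1 this is essential, since t = 0 is to the left of the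
    -- line.
    right
    rw [capacityBlock₃_eq]
    right
    refine ⟨1, by simp, N + N', ?_⟩
    simp [capacityBlock₁, capacityBlock₂] at hα hβ
    subst hα hβ
    push_cast
    ring
  -- Ψ₂ has no upper parameters, so there is no collision of this kind.
  · rintro τ _ s ⟨β, hβ, _⟩
    simp [capacityBlock₂] at hβ

theorem hasBivariateG_capacityBlock (b i : ℕ) {κ y : ℝ} (hκ : 0 < κ) (hy : 0 < y) :
    Meijer.HasBivariateG (capacityBlock₁ (b + i + 1) i) capacityBlock₂
      (capacityBlock₃ (b + i + 1) i) κ y ((y ^ (b + i) * logMoment b i κ y : ℝ) : ℂ) := by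
  refine ⟨exists_admissible b i, fun c L hL => ?_⟩
  obtain ⟨hc1, hc2⟩ := (outer_separates_iff b i c).1 hL.outer
  have hsep : ∀ t : ℂ, t.re = c → (L t).Separates (tripleLeft (b + 1) t) (tripleRight t) := by
    intro t ht
    rw [← innerLeft_capacityBlock b i, ← innerRight_capacityBlock b i]
    exact hL.inner t ht
  -- Re t is strictly between two consecutive integers; this makes the poles in s simple and Γ(-t)
  -- finite.
  have hint : ∀ t : ℂ, t.re = c → ∀ n : ℤ, t ≠ n := by
    rintro t ht n rfl
    rw [Complex.intCast_re] at ht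
    rw [← ht] at hc1 hc2
    have h1 : -((b + i : ℕ) : ℤ) < n := by exact_mod_cast hc1
    have h2 : n < 1 - ((b + i : ℕ) : ℤ) := by exact_mod_cast hc2
    omega
  have hinner : ∀ t : ℂ, t.re = c → (L t).integral (gammaTriple (b + 1) κ t) =
      2 * Real.pi * Complex.I * (Complex.Gamma (-t) * shiftedGamma b κ t) := by
    intro t ht
    refine integral_gammaTriple b hκ ?_ (hsep t ht)
    rcases Nat.eq_zero_or_pos (b + i) with h | h
    · right
      rw [h, Nat.cast_zero] at hc1 hc2
      rw [ht]
      exact ⟨by omega, by linarith, by linarith⟩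
    · left
      have h1 : (1 : ℝ) ≤ (b + i : ℕ) := by exact_mod_cast h
      exact ⟨by rw [ht]; linarith, hint t ht⟩
  set δ : ℝ := c + (b + i : ℕ) with hδ
  have h₀ : 0 < δ := by linarith
  have h₁ : δ < 1 := by linarith
  obtain ⟨hJi, hJ⟩ := integral_logMellin_mul_Gamma b i hκ hy h₀ h₁
  have hy0 : (y : ℂ) ≠ 0 := Complex.ofReal_ne_zero.2 hy.ne'
  have houter : ∀ v : ℝ, Meijer.outerIntegrand (capacityBlock₁ (b + i + 1) i) capacityBlock₂
      (capacityBlock₃ (b + i + 1) i) κ y L ((Meijer.lineContour c).line v) =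
      2 * Real.pi * Complex.I * (y : ℂ) ^ (b + i) *
        (logMellin (δ + v * Complex.I) * ((y : ℂ) ^ (-((δ : ℂ) + v * Complex.I)) *
      (Complex.Gamma (i + 1 + ((δ : ℂ) + v * Complex.I)) *
        shiftedGamma b κ ((δ : ℂ) + v * Complex.I - (b + i : ℕ))))) := by
    intro v
    have hline : (Meijer.lineContour c).line v = (δ : ℂ) + v * Complex.I - (b + i : ℕ) := by
      simp only [Meijer.lineContour, Meijer.Contour.line, hδ]
      push_cast
      ring
    have hre : ((δ : ℂ) + v * Complex.I - (b + i : ℕ)).re = c := by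
      simp [hδ]
    -- Needed to cancel Γ(-t) from the s-integral against 1/Γ(-t) from Ψ₃.
    have hΓ : Complex.Gamma (-((δ : ℂ) + v * Complex.I - (b + i : ℕ))) ≠ 0 := by
      refine Complex.Gamma_ne_zero fun k hk => hint _ hre k ?_
      push_cast at hk ⊢
      linear_combination -hk
    have hpow : (y : ℂ) ^ (-((δ : ℂ) + v * Complex.I - (b + i : ℕ))) =
        (y : ℂ) ^ (b + i) * (y : ℂ) ^ (-((δ : ℂ) + v * Complex.I)) := by
      rw [← Complex.cpow_natCast, ← Complex.cpow_add _ _ hy0]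
      congr 1
      ring
    rw [hline, Meijer.outerIntegrand, innerIntegrand_capacityBlock, hinner _ hre,
      kernel_capacityBlock₃ b i (by simpa using h₀), hpow]
    field_simp
  refine ⟨fun t ht => ?_, ?_, ?_⟩
  · rw [innerIntegrand_capacityBlock]
    exact integrable_gammaTriple_line (b + 1) hκ t (hsep t ht).off_line
  · simp only [houter]
    exact hJi.const_mul _
  · have : (Meijer.lineContour c).integral (Meijer.outerIntegrand (capacityBlock₁ (b + i + 1) i)
        capacityBlock₂ (capacityBlock₃ (b + i + 1) i) κ y L) =
        2 * Real.pi * Complex.I * (y : ℂ) ^ (b + i) * (2 * Real.pi * (logMoment b i κ y : ℂ)) *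
          Complex.I := by
      rw [Meijer.Contour.integral]
      simp only [houter]
      rw [integral_mul_const, integral_const_mul, hJ]
      simp [Meijer.lineContour]
    rw [this]
    have hpi : (Real.pi : ℂ) ≠ 0 := Complex.ofReal_ne_zero.2 Real.pi_ne_zero
    push_cast
    field_simp

/-- The existence clause supplies a contour, on which both values are the same integral; without it
the definition would hold vacuously. -/
theorem Meijer.HasBivariateG.unique {B₁ B₂ B₃ : Meijer.Block} {x y G G' : ℂ}
    (h : Meijer.HasBivariateG B₁ B₂ B₃ x y G) (h' : Meijer.HasBivariateG B₁ B₂ B₃ x y G') :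
    G = G' := by
  obtain ⟨c, L, hL⟩ := h.1
  exact (h.2 c L hL).2.2.symm.trans (h'.2 c L hL).2.2

theorem Meijer.HasBivariateG.bivariateG_eq {B₁ B₂ B₃ : Meijer.Block} {x y G : ℂ}
    (h : Meijer.HasBivariateG B₁ B₂ B₃ x y G) : Meijer.bivariateG B₁ B₂ B₃ x y = G := by
  have hex : ∃ G : ℂ, Meijer.HasBivariateG B₁ B₂ B₃ x y G := ⟨G, h⟩
  rw [Meijer.bivariateG, dif_pos hex]
  exact hex.choose_spec.unique h

/-! ### The density and the ergodic capacity -/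

/-- Kummer's transformation for a positive integer first parameter. -/
theorem kummerF_natCast_succ_one (M : ℕ) (z : ℝ) :
    kummerF ((M + 1 : ℕ) : ℝ) 1 z =
      Real.exp z * ∑ i ∈ Finset.range (M + 1), (M.choose i : ℝ) / i.factorial * z ^ i := by
  have ha0 : ∀ i ∉ Finset.range (M + 1), (M.choose i : ℝ) / i.factorial * z ^ i = 0 := by
    intro i hi
    rw [Finset.mem_range, not_lt] at hi
    rw [Nat.choose_eq_zero_of_lt (by omega)]
    simp
  have hsa : Summable fun i : ℕ => ‖(M.choose i : ℝ) / i.factorial * z ^ i‖ :=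
    summable_of_ne_finset_zero (s := Finset.range (M + 1)) fun i hi => by rw [ha0 i hi, norm_zero]
  have hsb : Summable fun j : ℕ => ‖z ^ j / (j.factorial : ℝ)‖ :=
    (Real.summable_pow_div_factorial z).norm
  have hexp : Real.exp z = ∑' j : ℕ, z ^ j / (j.factorial : ℝ) := by
    rw [Real.exp_eq_exp_ℝ, NormedSpace.exp_eq_tsum_div]
  rw [mul_comm, ← tsum_eq_sum (L := SummationFilter.unconditional ℕ) ha0, hexp,
    tsum_mul_tsum_eq_tsum_sum_antidiagonal_of_summable_norm hsa hsb, kummerF]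
  congr 1
  ext n
  have hn : (n.factorial : ℝ) ≠ 0 := Nat.cast_ne_zero.2 n.factorial_ne_zero
  have h1 : (ascPochhammer ℝ n).eval ((M + 1 : ℕ) : ℝ) = n.factorial * ((M + n).choose n : ℕ) := by
    rw [← ascPochhammer_eval_cast, ascPochhammer_nat_eq_ascFactorial,
      Nat.ascFactorial_eq_factorial_mul_choose]
    push_cast
    rfl
  -- The coefficient of z^n in the Cauchy product is a multiple of ∑ C(M,i) C(n,j) over i + j = n.
  -- Vandermonde's identity gives C(M+n,n), which is (M+1)_n / n!.
  have h2 : ∀ p ∈ Finset.HasAntidiagonal.antidiagonal n, (M.choose p.1 : ℝ) / p.1.factorial * z ^ p.1 *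
      (z ^ p.2 / p.2.factorial) = z ^ n / n.factorial * (M.choose p.1 * n.choose p.2 : ℕ) := by
    rintro ⟨i, j⟩ hij
    rw [Finset.HasAntidiagonal.mem_antidiagonal] at hij
    simp only at hij ⊢
    subst hij
    have h3 := Nat.add_choose_mul_factorial_mul_factorial i j
    have h4 : ((i + j).choose j : ℝ) * i.factorial * j.factorial = (i + j).factorial := by
      exact_mod_cast h3
    have hi : (i.factorial : ℝ) ≠ 0 := Nat.cast_ne_zero.2 i.factorial_ne_zero
    have hj : (j.factorial : ℝ) ≠ 0 := Nat.cast_ne_zero.2 j.factorial_ne_zero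
    push_cast
    rw [← h4] at hn ⊢
    have hc : ((i + j).choose j : ℝ) ≠ 0 := fun h => hn (by rw [h]; ring)
    rw [pow_add]
    field_simp
  rw [Finset.sum_congr rfl h2, ← Finset.mul_sum, ← Nat.cast_sum, ← Nat.add_choose_eq, h1,
    ascPochhammer_eval_one]
  field_simp

/-! ### Reduction of the capacity to logarithmic moments -/

/-- The summand `y^{i+1} γ^i x^b (x + κ)^{-(b+2i+1)} e^{-yγ/(x+κ)}` of the conditional density. -/
def condTerm (b i : ℕ) (κ y γ x : ℝ) : ℝ :=
  y ^ (i + 1) * γ ^ i * x ^ b * ((x + κ) ^ (b + 2 * i + 1))⁻¹ * Real.exp (-(y * γ / (x + κ)))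

/-- In terms of κ and y the Kummer argument is κyγ/(x(x+κ)); its exponential turns e^{-yγ/x} into
e^{-yγ/(x+κ)}, which removes the singular behaviour at x = 0. -/
theorem condPdf_eq_sum (M : ℕ) {k snr x : ℝ} (γ : ℝ) (hk : 0 < k) (hsnr : 0 < snr) (hx : 0 < x) :
    FdRLoS.condPdf ((M + 1 : ℕ) : ℝ) k snr x γ = ∑ i ∈ Finset.range (M + 1),
      (M.choose i : ℝ) / i.factorial * (k / ((M + 1 : ℕ) : ℝ)) ^ i *
        condTerm (M - i) i (k / ((M + 1 : ℕ) : ℝ)) ((k + 1) / snr) γ x := by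
  have hm : (0 : ℝ) < ((M + 1 : ℕ) : ℝ) := by positivity
  rw [FdRLoS.condPdf, kummerF_natCast_succ_one, Real.rpow_natCast, Real.rpow_natCast, FdRLoS.condK,
    FdRLoS.condSNR]
  generalize hmm : ((M + 1 : ℕ) : ℝ) = m at hm ⊢
  set κ : ℝ := k / m with hκ
  set y : ℝ := (k + 1) / snr with hy
  have hkm : k = κ * m := by
    rw [hκ]
    field_simp
  have hκ0 : 0 < κ := by positivity
  have hy0 : 0 < y := by positivity
  have hz : k / x * (1 + k / x) / (k / x + m) * (γ / ((k + x) / (k + 1) * snr)) =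
      κ * y * γ / (x * (x + κ)) := by
    have : k + m * x ≠ 0 := by positivity
    rw [hκ, hy]
    field_simp
    ring
  have he : (1 + k / x) / ((k + x) / (k + 1) * snr) * γ = y * γ / x := by
    rw [hy]
    field_simp
    ring
  have hpre : m ^ (M + 1) * (1 + k / x) / ((m + k / x) ^ (M + 1) * ((k + x) / (k + 1) * snr)) =
      y * x ^ M * ((x + κ) ^ (M + 1))⁻¹ := by
    have h1 : m + k / x = m * (x + κ) / x := by
      rw [hkm]
      field_simp
    have h2 : (1 + k / x) / ((k + x) / (k + 1) * snr) = y / x := by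
      rw [hy]
      field_simp
      ring
    rw [h1, mul_comm (_ ^ _) ((k + x) / (k + 1) * snr), ← div_div, mul_div_assoc, h2, div_pow,
      mul_pow, pow_succ x M]
    field_simp
  have hexp : Real.exp (-(y * γ / x)) * Real.exp (κ * y * γ / (x * (x + κ))) =
      Real.exp (-(y * γ / (x + κ))) := by
    rw [← Real.exp_add]
    congr 1
    field_simp
    ring
  rw [hz, he, hpre, ← mul_assoc, mul_assoc _ (Real.exp _) (Real.exp _), hexp, Finset.mul_sum]
  refine Finset.sum_congr rfl fun i hi => ?_
  obtain ⟨b, rfl⟩ : ∃ b, M = b + i := ⟨M - i, by rw [Finset.mem_range] at hi; omega⟩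
  rw [Nat.add_sub_cancel, condTerm, div_pow, mul_pow, mul_pow, mul_pow]
  have hxκ : x + κ ≠ 0 := by positivity
  rw [show b + 2 * i + 1 = (b + i + 1) + i by ring, pow_add (x + κ) (b + i + 1) i, pow_add x b i, pow_succ y i]
  field_simp

theorem condTerm_nonneg (b i : ℕ) {κ y γ x : ℝ} (hκ : 0 < κ) (hy : 0 < y) (hγ : 0 < γ)
    (hx : 0 < x) : 0 ≤ condTerm b i κ y γ x := by
  rw [condTerm]
  positivity

theorem integrableOn_condTerm (b i : ℕ) {κ y γ : ℝ} (hκ : 0 < κ) (hy : 0 < y) (hγ : 0 < γ) :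
    IntegrableOn (fun x : ℝ => condTerm b i κ y γ x * Real.exp (-x)) (Ioi 0) := by
  refine ((integrableOn_pow_mul_exp_neg_mul b one_pos).const_mul
    (y ^ (i + 1) * γ ^ i * (κ ^ (b + 2 * i + 1))⁻¹)).mono' ?_ ?_
  · refine Measurable.aestronglyMeasurable ?_
    simp only [condTerm]
    fun_prop
  · filter_upwards [ae_restrict_mem measurableSet_Ioi] with x hx
    have hx' : (0 : ℝ) < x := hx
    rw [Real.norm_eq_abs, abs_of_nonneg (mul_nonneg (condTerm_nonneg b i hκ hy hγ hx')
      (Real.exp_pos _).le), condTerm]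
    have h1 : Real.exp (-(y * γ / (x + κ))) ≤ 1 := by
      rw [Real.exp_le_one_iff, neg_nonpos]
      positivity
    calc _ ≤ y ^ (i + 1) * γ ^ i * x ^ b * (κ ^ (b + 2 * i + 1))⁻¹ * 1 * Real.exp (-x) := by
          gcongr
          linarith
      _ = _ := by
        rw [one_mul]
        ring

theorem integrable_gammaWeight_mul_log (b i : ℕ) {κ y : ℝ} (hκ : 0 < κ) (hy : 0 < y) :
    Integrable (fun z : ℝ × ℝ => gammaWeight b i κ z.1 z.2 *
      Real.log (1 + z.1 * (z.2 + κ) / y)) quadrantMeasure := by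
  -- The logarithm is bounded by twice the square root of its argument minus 1.
  have h := gammaWeight_mul_rpow_integrable b i hκ hy (δ := 1 / 2) (by norm_num) (by norm_num)
  refine (h.norm.const_mul 2).mono' ?_ ?_
  · exact ((measurable_gammaWeight b i κ).mul (by fun_prop)).aestronglyMeasurable
  · filter_upwards [ae_quadrant] with z hz
    have hz1 := hz.1
    have hz2 := hz.2
    have h3 : 0 < z.1 * (z.2 + κ) / y := by positivity
    have hw : 0 ≤ gammaWeight b i κ z.1 z.2 := by
      rw [gammaWeight]
      positivity
    rw [norm_mul, norm_mul, Complex.norm_cpow_eq_rpow_re_of_pos h3, Complex.norm_real,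
      Complex.ofReal_re, Real.norm_eq_abs (Real.log _),
      abs_of_nonneg (Real.log_nonneg (by linarith)), mul_left_comm]
    gcongr
    have := Real.log_one_add_le_rpow h3.le (ε := 1 / 2) (by norm_num) (by norm_num)
    linarith

/-- The substitution γ = g(x+κ)/y; the factor y/(x+κ) is the inverse of its Jacobian. -/
theorem condTerm_scaling (b i : ℕ) {κ y x : ℝ} (g : ℝ) (hκ : 0 < κ) (hy : 0 < y) (hx : 0 < x) :
    Real.log (1 + (x + κ) / y * g) * (condTerm b i κ y ((x + κ) / y * g) x * Real.exp (-x)) =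
      y / (x + κ) * (gammaWeight b i κ g x * Real.log (1 + g * (x + κ) / y)) := by
  have hxκ : x + κ ≠ 0 := by positivity
  rw [condTerm, gammaWeight, show (x + κ) / y * g = g * (x + κ) / y by ring,
    show y * (g * (x + κ) / y) / (x + κ) = g by field_simp, div_pow, mul_pow]
  rw [show b + 2 * i + 1 = (b + i) + (i + 1) by ring, pow_add (x + κ) (b + i) (i + 1),
    pow_succ y i, pow_succ (x + κ) i]
  field_simp

/-- For each x, rescale γ, then apply Fubini with γ as the inner variable. Nonnegativity carries
integrability over from the rescaled integrand. -/
theorem integral_log_mul_condTerm (b i : ℕ) {κ y : ℝ} (hκ : 0 < κ) (hy : 0 < y) :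
    Integrable (fun z : ℝ × ℝ => Real.log (1 + z.1) * (condTerm b i κ y z.1 z.2 *
      Real.exp (-z.2))) quadrantMeasure ∧
    ∫ z, Real.log (1 + z.1) * (condTerm b i κ y z.1 z.2 * Real.exp (-z.2)) ∂quadrantMeasure =
      logMoment b i κ y := by
  have hW := integrable_gammaWeight_mul_log b i hκ hy
  have hmeas : Measurable fun z : ℝ × ℝ => Real.log (1 + z.1) * (condTerm b i κ y z.1 z.2 *
      Real.exp (-z.2)) := by
    simp only [condTerm]
    fun_prop
  have hval : ∀ x ∈ Ioi (0 : ℝ), ∫ γ in Ioi (0 : ℝ), Real.log (1 + γ) * (condTerm b i κ y γ x *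
      Real.exp (-x)) =
      ∫ g in Ioi (0 : ℝ), gammaWeight b i κ g x * Real.log (1 + g * (x + κ) / y) := by
    intro x hx
    have hx' : (0 : ℝ) < x := hx
    have hr : 0 < (x + κ) / y := by positivity
    have h1 := integral_comp_mul_left_Ioi (fun γ : ℝ => Real.log (1 + γ) *
      (condTerm b i κ y γ x * Real.exp (-x))) 0 hr
    simp only [condTerm_scaling b i _ hκ hy hx', mul_zero, smul_eq_mul] at h1
    rw [integral_const_mul, inv_div] at h1
    exact (mul_left_cancel₀ (by positivity) h1).symm
  have hint : Integrable (fun z : ℝ × ℝ => Real.log (1 + z.1) * (condTerm b i κ y z.1 z.2 *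
      Real.exp (-z.2))) quadrantMeasure := by
    rw [integrable_prod_iff' hmeas.aestronglyMeasurable]
    constructor
    · filter_upwards [hW.prod_left_ae, ae_restrict_mem measurableSet_Ioi] with x hx1 hx
      have hx' : (0 : ℝ) < x := hx
      have hr : 0 < (x + κ) / y := by positivity
      have h1 := integrableOn_Ioi_comp_mul_left_iff (fun γ : ℝ => Real.log (1 + γ) *
        (condTerm b i κ y γ x * Real.exp (-x))) 0 hr
      simp only [condTerm_scaling b i _ hκ hy hx', mul_zero] at h1
      exact h1.1 (hx1.const_mul _)
    · refine hW.integral_prod_right.congr ?_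
      filter_upwards [ae_restrict_mem measurableSet_Ioi] with x hx
      rw [← hval x hx]
      refine setIntegral_congr_fun measurableSet_Ioi fun γ hγ => ?_
      have hγ' : (0 : ℝ) < γ := hγ
      have hx' : (0 : ℝ) < x := hx
      rw [Real.norm_eq_abs, abs_of_nonneg]
      exact mul_nonneg (Real.log_nonneg (by linarith)) (mul_nonneg
        (condTerm_nonneg b i hκ hy hγ' hx') (Real.exp_pos _).le)
  refine ⟨hint, ?_⟩
  rw [integral_prod_symm _ hint, logMoment, integral_prod_symm _ hW]
  exact setIntegral_congr_fun measurableSet_Ioi hval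

theorem integrableOn_condPdf (M : ℕ) {k snr γ : ℝ} (hk : 0 < k) (hsnr : 0 < snr) (hγ : 0 < γ) :
    IntegrableOn (fun x : ℝ => FdRLoS.condPdf ((M + 1 : ℕ) : ℝ) k snr x γ * Real.exp (-x))
      (Ioi 0) := by
  have h := integrable_finsetSum (μ := volume.restrict (Ioi (0 : ℝ))) (Finset.range (M + 1))
    fun i _ => (integrableOn_condTerm (M - i) i (κ := k / ((M + 1 : ℕ) : ℝ))
      (y := (k + 1) / snr) (by positivity) (by positivity) hγ).const_mul
      ((M.choose i : ℝ) / i.factorial * (k / ((M + 1 : ℕ) : ℝ)) ^ i)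
  refine h.congr ?_
  filter_upwards [ae_restrict_mem measurableSet_Ioi] with x hx
  rw [condPdf_eq_sum M γ hk hsnr hx, Finset.sum_mul]
  exact Finset.sum_congr rfl fun i _ => by ring

theorem integral_logb_mul_pdf (M : ℕ) {k snr : ℝ} (hk : 0 < k) (hsnr : 0 < snr) :
    IntegrableOn (fun γ : ℝ => Real.logb 2 (1 + γ) * FdRLoS.pdf ((M + 1 : ℕ) : ℝ) k snr γ)
      (Ioi 0) ∧
    FdRLoS.capacityORA ((M + 1 : ℕ) : ℝ) k snr = (∑ i ∈ Finset.range (M + 1),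
      (M.choose i : ℝ) / i.factorial * (k / ((M + 1 : ℕ) : ℝ)) ^ i *
        logMoment (M - i) i (k / ((M + 1 : ℕ) : ℝ)) ((k + 1) / snr)) / Real.log 2 := by
  set κ : ℝ := k / ((M + 1 : ℕ) : ℝ) with hκ
  set y : ℝ := (k + 1) / snr with hy
  have hκ0 : 0 < κ := by positivity
  have hy0 : 0 < y := by positivity
  set Φ : ℕ → ℝ × ℝ → ℝ := fun i z => (M.choose i : ℝ) / i.factorial * κ ^ i *
    (Real.log (1 + z.1) * (condTerm (M - i) i κ y z.1 z.2 * Real.exp (-z.2))) with hΦ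
  have hΦi : ∀ i ∈ Finset.range (M + 1), Integrable (Φ i) quadrantMeasure := fun i _ =>
    (integral_log_mul_condTerm (M - i) i hκ0 hy0).1.const_mul _
  have hsum := integrable_finsetSum (Finset.range (M + 1)) hΦi
  have hpdf : ∀ γ ∈ Ioi (0 : ℝ), (∫ x in Ioi (0 : ℝ), ∑ i ∈ Finset.range (M + 1), Φ i (γ, x)) /
      Real.log 2 = Real.logb 2 (1 + γ) * FdRLoS.pdf ((M + 1 : ℕ) : ℝ) k snr γ := by
    intro γ _
    rw [FdRLoS.pdf, Real.logb, div_mul_eq_mul_div, ← integral_const_mul]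
    congr 1
    refine setIntegral_congr_fun measurableSet_Ioi fun x hx => ?_
    rw [condPdf_eq_sum M γ hk hsnr hx, Finset.sum_mul, Finset.mul_sum]
    refine Finset.sum_congr rfl fun i _ => ?_
    simp only [hΦ]
    ring
  constructor
  · refine (hsum.integral_prod_left.div_const (Real.log 2)).congr ?_
    filter_upwards [ae_restrict_mem measurableSet_Ioi] with γ hγ using hpdf γ hγ
  · rw [FdRLoS.capacityORA, ← setIntegral_congr_fun measurableSet_Ioi hpdf, integral_div,
      ← integral_prod (fun z : ℝ × ℝ => ∑ i ∈ Finset.range (M + 1), Φ i z) hsum,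
      integral_finsetSum _ hΦi]
    congr 1
    refine Finset.sum_congr rfl fun i _ => ?_
    simp only [hΦ]
    rw [integral_const_mul, (integral_log_mul_condTerm (M - i) i hκ0 hy0).2]

theorem bivariateG_capacityBlock (M : ℕ) {i : ℕ} (hi : i < M + 1) {κ y : ℝ} (hκ : 0 < κ)
    (hy : 0 < y) :
    Meijer.HasBivariateG (capacityBlock₁ (M + 1) i) capacityBlock₂ (capacityBlock₃ (M + 1) i) κ y
      ((y ^ M * logMoment (M - i) i κ y : ℝ) : ℂ) := by
  obtain ⟨b, rfl⟩ : ∃ b, M = b + i := ⟨M - i, by omega⟩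
  rw [Nat.add_sub_cancel]
  exact hasBivariateG_capacityBlock b i hκ hy

end

theorem theorem2 (m : ℕ) (hm : 1 ≤ m) (k snr : ℝ) (hk : 0 < k) (hsnr : 0 < snr) :
    -- the integrals defining the density and the ergodic capacity converge
    (∀ γ : ℝ, 0 < γ →
      IntegrableOn (fun x : ℝ => FdRLoS.condPdf m k snr x γ * Real.exp (-x)) (Ioi 0)) ∧
    IntegrableOn (fun γ : ℝ => Real.logb 2 (1 + γ) * FdRLoS.pdf m k snr γ) (Ioi 0) ∧
    -- the Meijer G-functions are given by convergent integrals, independent of the contours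
    (∀ i < m, Meijer.HasBivariateG (capacityBlock₁ m i) capacityBlock₂ (capacityBlock₃ m i)
      ((k / m : ℝ) : ℂ) (((k + 1) / snr : ℝ) : ℂ)
      (Meijer.bivariateG (capacityBlock₁ m i) capacityBlock₂ (capacityBlock₃ m i)
        ((k / m : ℝ) : ℂ) (((k + 1) / snr : ℝ) : ℂ))) ∧
    -- the closed form of the ergodic capacity
    ((FdRLoS.capacityORA m k snr : ℝ) : ℂ) =
      (((snr / (k + 1)) ^ (m - 1) * Real.Gamma m / Real.log 2 : ℝ) : ℂ) *
        ∑ i ∈ Finset.range m,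
          (((k / m) ^ i / ((i.factorial : ℝ) ^ 2 * Real.Gamma ((m : ℝ) - i)) : ℝ) : ℂ) *
            Meijer.bivariateG (capacityBlock₁ m i) capacityBlock₂ (capacityBlock₃ m i)
              ((k / m : ℝ) : ℂ) (((k + 1) / snr : ℝ) : ℂ) := by
  obtain ⟨M, rfl⟩ : ∃ M, m = M + 1 := ⟨m - 1, by omega⟩
  have hκ : 0 < k / ((M + 1 : ℕ) : ℝ) := by positivity
  have hy : 0 < (k + 1) / snr := by positivity
  have hG := fun i (hi : i < M + 1) => bivariateG_capacityBlock M hi hκ hy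
  refine ⟨fun γ hγ => integrableOn_condPdf M hk hsnr hγ, (integral_logb_mul_pdf M hk hsnr).1,
    fun i hi => ?_, ?_⟩
  · rw [(hG i hi).bivariateG_eq]
    exact hG i hi
  · rw [Finset.sum_congr rfl fun i hi => by
      rw [(hG i (Finset.mem_range.1 hi)).bivariateG_eq], (integral_logb_mul_pdf M hk hsnr).2]
    simp only [← Complex.ofReal_mul, ← Complex.ofReal_sum]
    congr 1
    rw [Finset.mul_sum, Finset.sum_div]
    refine Finset.sum_congr rfl fun i hi => ?_
    obtain ⟨b, rfl⟩ : ∃ b, M = b + i := ⟨M - i, by rw [Finset.mem_range] at hi; omega⟩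
    -- Together with `h2`: Γ(m)/((i!)² Γ(m-i)) = C(m-1,i)/i!, the coefficient from Kummer's
    -- transformation.
    have h1 : Real.Gamma ((b + i + 1 : ℕ) : ℝ) = ((b + i).choose i : ℝ) * i.factorial *
        b.factorial := by
      rw [Nat.cast_succ, Real.Gamma_nat_eq_factorial]
      have := Nat.add_choose_mul_factorial_mul_factorial b i
      rw [← this]
      push_cast
      ring
    have h2 : Real.Gamma (((b + i + 1 : ℕ) : ℝ) - i) = b.factorial := by
      rw [← Real.Gamma_nat_eq_factorial]
      congr 1
      push_cast
      ring
    have hi0 : (i.factorial : ℝ) ≠ 0 := Nat.cast_ne_zero.2 i.factorial_ne_zero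
    have hb0 : (b.factorial : ℝ) ≠ 0 := Nat.cast_ne_zero.2 b.factorial_ne_zero
    -- The power of γ̄/(k+1) in the prefactor undoes the y^{m-1} carried by each G_i.
    have hs : (snr / (k + 1)) ^ (b + i) * ((k + 1) / snr) ^ (b + i) = 1 := by
      rw [← mul_pow, div_mul_div_comm, mul_comm snr, div_self (by positivity), one_pow]
    rw [h1, h2, Nat.add_sub_cancel, Nat.add_sub_cancel]
    generalize logMoment b i (k / ((b + i + 1 : ℕ) : ℝ)) ((k + 1) / snr) = W
    generalize (k / ((b + i + 1 : ℕ) : ℝ)) ^ i = K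
    generalize (snr / (k + 1)) ^ (b + i) = P at hs ⊢
    generalize ((k + 1) / snr) ^ (b + i) = Q at hs ⊢
    calc _ = (P * Q) * (((b + i).choose i : ℝ) / i.factorial * K * W / Real.log 2) := by
          rw [hs, one_mul]
      _ = _ := by field_simp
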